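/- Let $m\in\mathbb N$. **Notation.** Let $\vec\Phi$ be a smooth immersion of a two-dimensional smooth manifold $\Sigma^2$ into $\mathbb{R}^m$, with induced metric $g=\vec\Phi^*g_{\mathbb{R}^m}$; in local coordinates $g_{ij}=\langle\partial_{x_i}\vec\Phi,\partial_{x_j}\vec\Phi\rangle$ and $(g^{ij})=(g_{ij})^{-1}$. Let $\pi_{\vec n}$ be the orthogonal projection of $\mathbb{R}^m$ onto the normal space $(\vec\Phi_*T\Sigma^2)^\perp$, $\vec{\mathbb I}(X,Y)=\pi_{\vec n}(d^2\vec\Phi(X,Y))$ the second fundamental form, $\vec H=\frac12\sum_{i,j}g^{ij}\,\vec{\mathbb I}(\partial_{x_i},\partial_{x_j})$ the mean curvature vector, and $\tilde A(\vec X)=\sum_{i,j=1}^2\langle\vec{\mathbb I}(e_i,e_j),\vec X\rangle\,\vec{\mathbb I}(e_i,e_j)$ for any $g$-orthonormal basis $(e_1,e_2)$ of the tangent space. Let $\star$ be the Hodge operator $\wedge^p\mathbb{R}^m\to\wedge^{m-p}\mathbb{R}^m$, characterized by $\beta\wedge\star\alpha=\langle\beta,\alpha\rangle\,\varepsilon_1\wedge\cdots\wedge\varepsilon_m$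 ($1$-vectors are identified with vectors). For a local orientation of $\Sigma^2$, let $*_g$ be the Hodge operator of $g$ on forms ($\alpha\wedge *_g\beta=\langle\alpha,\beta\rangle_g\,dvol_g$), $d^{*_g}=-*_g d\,*_g$ the codifferential on $1$-forms, and $\vec n=\star(\vec e_1\wedge\vec e_2)\in\wedge^{m-2}\mathbb{R}^m$ the Gauss map, where $(\vec e_1,\vec e_2)$ is a positive orthonormal basis of $\vec\Phi_*T\Sigma^2$; the expression $\star(*_g d\vec n\wedge\vec H)$ does not depend on the orientation. Finally $\Delta_\perp\vec X=-\pi_{\vec n}\big[d^{*_g}\big(\pi_{\vec n}(d\vec X)\big)\big]$ is the (negative) covariant Laplacian of normal fields $\vec X$. **(1)** For every smooth immersion $\vec\Phi$ of a two-dimensional smooth manifold $\Sigma^2$ into $\mathbb{R}^m$, the following identity holds on $\Sigma^2$: $$\Delta_\perp\vec H+\tilde A(\vec H)-2|\vec H|^2\vec H=\tfrac12\, d^{*_g}\Big[d\vec H-3\,\pi_{\vec n}(d\vec H)+\star(*_g d\vec n\wedge\vec H)\Big].$$ **(2)** Let $D^2$ be the open unit disc of $\mathbb{R}^2$ and let $\vec\Phi:D^2\to\mathbb{R}^m$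 be a smooth immersion which is conformal, that is $|\partial_{x_1}\vec\Phi|=|\partial_{x_2}\vec\Phi|$ and $\langle\partial_{x_1}\vec\Phi,\partial_{x_2}\vec\Phi\rangle=0$, and has finite Willmore energy $W(\vec\Phi)=\int_{D^2}|\vec H|^2\,dvol_g<+\infty$. Then $\vec\Phi$ is Willmore, that is $\frac{d}{dt}W(\vec\Phi+t\vec\xi)\big|_{t=0}=0$ for all $\vec\xi\in C^\infty_0(D^2,\mathbb{R}^m)$, if and only if $$\mathrm{div}\Big[\nabla\vec H-3\,\pi_{\vec n}(\nabla\vec H)+\star(\nabla^\perp\vec n\wedge\vec H)\Big]=0\quad\text{on }D^2,$$ where $\mathrm{div}\,X=\partial_{x_1}X_1+\partial_{x_2}X_2$, $\nabla u=(\partial_{x_1}u,\partial_{x_2}u)$ and $\nabla^\perp u=(-\partial_{x_2}u,\partial_{x_1}u)$ are the flat operators. -/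

import Mathlib

open scoped ContDiff Manifold

noncomputable section

namespace WillmoreConservation

/-- The coordinate plane `ℝ²`. -/
abbrev Plane : Type := EuclideanSpace ℝ (Fin 2)

/-- The ambient Euclidean space `ℝᵐ`. -/
abbrev Amb (m : ℕ) : Type := EuclideanSpace ℝ (Fin m)

/-- The coordinate vector field `∂_{x_i}`. -/
def coordVec (i : Fin 2) : Plane := EuclideanSpace.single i 1

/-- The partial derivative `∂_{x_i} u` of a map defined on (a part of) the plane. -/
def pd {W : Type*} [NormedAddCommGroup W] [NormedSpace ℝ W] (i : Fin 2) (u : Plane → W)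
    (x : Plane) : W :=
  fderiv ℝ u x (coordVec i)

/-! ### Multivectors of `ℝᵐ` -/

/-- The Grassmann algebra `⋀ ℝᵐ`; its product is the wedge product. -/
abbrev Multivec (m : ℕ) : Type := ExteriorAlgebra ℝ (Amb m)

/-- The basis of `⋀ ℝᵐ` made of the `ε_{i₁} ∧ ⋯ ∧ ε_{i_p}`, `i₁ < ⋯ < i_p`, indexed by the sets
`{i₁, …, i_p}`, where `ε` is the canonical basis of `ℝᵐ`. It is orthonormal for the canonical
scalar product on multivectors. -/
def multiBasis (m : ℕ) : Module.Basis (Finset (Fin m)) ℝ (Multivec m) :=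
  (EuclideanSpace.basisFun (Fin m) ℝ).toBasis.ExteriorAlgebra

/-- A vector of `ℝᵐ` as a `1`-vector. -/
def toMulti {m : ℕ} (v : Amb m) : Multivec m := ExteriorAlgebra.ι ℝ v

/-- The vector of `ℝᵐ` given by a `1`-vector. -/
def toVec {m : ℕ} (a : Multivec m) : Amb m := ExteriorAlgebra.ιInv a

/-- The Hodge operator `⋆ : ⋀ᵖ ℝᵐ → ⋀ᵐ⁻ᵖ ℝᵐ` (for all `p` at once), the linear map for which
`β ∧ ⋆α = ⟨β, α⟩ ε₁ ∧ ⋯ ∧ ε_m` for all `p`-vectors `α, β`. On the orthonormal basis, `⋆ ε_S` is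
`± ε_{Sᶜ}`, where the sign is the coefficient of `ε_S ∧ ε_{Sᶜ}` on `ε₁ ∧ ⋯ ∧ ε_m`. -/
def hodge (m : ℕ) : Multivec m →ₗ[ℝ] Multivec m :=
  (multiBasis m).constr ℝ fun S =>
    (multiBasis m).repr (multiBasis m S * multiBasis m Sᶜ) Finset.univ • multiBasis m Sᶜ

/-- The partial derivative of a multivector-valued map, taken on the coefficients in the canonical
basis. -/
def pdMulti {m : ℕ} (i : Fin 2) (u : Plane → Multivec m) (x : Plane) : Multivec m :=
  ∑ S : Finset (Fin m), pd i (fun y => (multiBasis m).repr (u y) S) x • multiBasis m S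

/-! ### Geometry of a surface patch

Here `f` is a smooth immersion of an open set of the plane into `ℝᵐ`: an immersion of a surface
read in local coordinates `(x₁, x₂)`. One-forms with values in a vector space `W` are given by their
two components `α i x = α_x(∂_{x_i})`. The orientation of the surface is the one for which the
coordinates are positive. -/

section Patch

variable {m : ℕ}

/-- The tangent plane `f_* T_x`, a subspace of `ℝᵐ`. -/
def tangentPlane (f : Plane → Amb m) (x : Plane) : Submodule ℝ (Amb m) :=
  LinearMap.range (fderiv ℝ f x).toLinearMap

/-- The orthogonal projection `π_n` onto the normal space to the tangent plane. -/
def normalProj (f : Plane → Amb m) (x : Plane) : Amb m →L[ℝ] Amb m :=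
  (tangentPlane f x)ᗮ.starProjection

/-- The matrix `g_{ij} = ⟨∂_{x_i} f, ∂_{x_j} f⟩` of the first fundamental form. -/
def metric (f : Plane → Amb m) (x : Plane) : Matrix (Fin 2) (Fin 2) ℝ :=
  Matrix.of fun i j => inner ℝ (pd i f x) (pd j f x)

/-- The inverse matrix `g^{ij}`. -/
def metricInv (f : Plane → Amb m) (x : Plane) : Matrix (Fin 2) (Fin 2) ℝ :=
  (metric f x)⁻¹

/-- The density `√(det g)` of the area form `dvol_g`. -/
def areaDensity (f : Plane → Amb m) (x : Plane) : ℝ :=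
  Real.sqrt (metric f x).det

/-- The second fundamental form `𝕀_x(X, Y) = π_n (d²f(X, Y))`. -/
def secondForm (f : Plane → Amb m) (x : Plane) (X Y : Plane) : Amb m :=
  normalProj f x (fderiv ℝ (fderiv ℝ f) x X Y)

/-- The mean curvature vector `H = ½ ∑ g^{ij} 𝕀(∂_{x_i}, ∂_{x_j})`. -/
def meanCurv (f : Plane → Amb m) (x : Plane) : Amb m :=
  (1 / 2 : ℝ) • ∑ i, ∑ j, metricInv f x i j • secondForm f x (coordVec i) (coordVec j)

/-- The map `Ã(X) = ∑ ⟨𝕀(e_i, e_j), X⟩ 𝕀(e_i, e_j)`, where `(e₁, e₂)` is meant to be an orthonormal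
basis of the tangent space at `x` for the induced metric. -/
def tildeA (f : Plane → Amb m) (x : Plane) (e : Fin 2 → Plane) (X : Amb m) : Amb m :=
  ∑ i, ∑ j, inner ℝ (secondForm f x (e i) (e j)) X • secondForm f x (e i) (e j)

/-- The Gauss map `n = ⋆(e₁ ∧ e₂)`, an `(m-2)`-vector, where
`e₁ ∧ e₂ = (∂_{x_1} f ∧ ∂_{x_2} f) / √(det g)` for each positive orthonormal basis `(e₁, e₂)` of the
tangent plane. -/
def gaussMap (f : Plane → Amb m) (x : Plane) : Multivec m :=
  hodge m ((areaDensity f x)⁻¹ • (toMulti (pd 0 f x) * toMulti (pd 1 f x)))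

/-- The Hodge operator `*_g` on one-forms, `α ∧ *_g β = ⟨α, β⟩_g dvol_g`. In coordinates
`(*_g α)_1 = -√(det g) ∑ g^{i2} α_i` and `(*_g α)_2 = √(det g) ∑ g^{i1} α_i`. -/
def starOne {W : Type*} [AddCommGroup W] [Module ℝ W] (f : Plane → Amb m)
    (α : Fin 2 → Plane → W) : Fin 2 → Plane → W :=
  ![fun x => -(areaDensity f x • ∑ i, metricInv f x i 1 • α i x),
    fun x => areaDensity f x • ∑ i, metricInv f x i 0 • α i x]

/-- The Hodge operator `*_g` on two-forms `a dx₁ ∧ dx₂`, given by their coefficient `a`. -/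
def starTwo (f : Plane → Amb m) (a : Plane → Amb m) (x : Plane) : Amb m :=
  (areaDensity f x)⁻¹ • a x

/-- The exterior differential of a one-form, as the coefficient of `dx₁ ∧ dx₂`. -/
def extD (α : Fin 2 → Plane → Amb m) (x : Plane) : Amb m :=
  pd 0 (α 1) x - pd 1 (α 0) x

/-- The codifferential `d^{*_g} = - *_g d *_g` on one-forms with values in `ℝᵐ`. -/
def codiff (f : Plane → Amb m) (α : Fin 2 → Plane → Amb m) (x : Plane) : Amb m :=
  -starTwo f (extD (starOne f α)) x

/-- The one-form `π_n(dX)`. -/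
def normalD (f : Plane → Amb m) (X : Plane → Amb m) (i : Fin 2) (x : Plane) : Amb m :=
  normalProj f x (pd i X x)

/-- The negative covariant Laplacian of the normal bundle,
`Δ_⊥ X = -π_n (d^{*_g} (π_n (dX)))`. -/
def normalLaplacian (f : Plane → Amb m) (X : Plane → Amb m) (x : Plane) : Amb m :=
  -normalProj f x (codiff f (normalD f X) x)

/-- The one-form `dH - 3 π_n(dH) + ⋆(*_g dn ∧ H)` with values in `ℝᵐ`. -/
def conservedForm (f : Plane → Amb m) (i : Fin 2) (x : Plane) : Amb m :=
  pd i (meanCurv f) x - (3 : ℝ) • normalD f (meanCurv f) i x +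
    toVec (hodge m
      (starOne f (fun j => pdMulti j (gaussMap f)) i x * toMulti (meanCurv f x)))

/-! ### The flat operators and Willmore discs -/

/-- The vector field `∇^⊥ n = (-∂_{x_2} n, ∂_{x_1} n)` for the Gauss map `n`. -/
def perpGradGauss (f : Plane → Amb m) : Fin 2 → Plane → Multivec m :=
  ![fun x => -pdMulti 1 (gaussMap f) x, fun x => pdMulti 0 (gaussMap f) x]

/-- The vector field `∇H - 3 π_n(∇H) + ⋆(∇^⊥ n ∧ H)`. -/
def conservedField (f : Plane → Amb m) (i : Fin 2) (x : Plane) : Amb m :=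
  pd i (meanCurv f) x - (3 : ℝ) • normalProj f x (pd i (meanCurv f) x) +
    toVec (hodge m (perpGradGauss f i x * toMulti (meanCurv f x)))

/-- The flat divergence `∂_{x_1} X_1 + ∂_{x_2} X_2`. -/
def flatDiv (X : Fin 2 → Plane → Amb m) (x : Plane) : Amb m :=
  pd 0 (X 0) x + pd 1 (X 1) x

/-- The open unit disc `D²`. -/
def disc : Set Plane := Metric.ball 0 1

/-- Smooth immersions of the disc. -/
structure IsDiscImmersion (f : Plane → Amb m) : Prop where
  smooth : ContDiffOn ℝ ∞ f disc
  injective : ∀ x ∈ disc, Function.Injective (fderiv ℝ f x)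

/-- Conformality on the disc: `|∂_{x_1} f| = |∂_{x_2} f|` and `⟨∂_{x_1} f, ∂_{x_2} f⟩ = 0`. -/
def IsConformalOnDisc (f : Plane → Amb m) : Prop :=
  ∀ x ∈ disc, ‖pd 0 f x‖ = ‖pd 1 f x‖ ∧ inner ℝ (pd 0 f x) (pd 1 f x) = 0

/-- Finiteness of the Willmore energy `∫_{D²} |H|² dvol_g`. -/
def HasFiniteEnergy (f : Plane → Amb m) : Prop :=
  MeasureTheory.IntegrableOn (fun x => ‖meanCurv f x‖ ^ 2 * areaDensity f x) disc

/-- The Willmore energy `W(f) = ∫_{D²} |H|² dvol_g`. -/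
def energy (f : Plane → Amb m) : ℝ :=
  ∫ x in disc, ‖meanCurv f x‖ ^ 2 * areaDensity f x

/-- A Willmore immersion of the disc: a smooth immersion of finite Willmore energy, critical for all
smooth variations with compact support in the disc. -/
structure IsWillmoreDisc (f : Plane → Amb m) : Prop where
  immersion : IsDiscImmersion f
  finite : HasFiniteEnergy f
  critical : ∀ ξ : Plane → Amb m, ContDiff ℝ ∞ ξ → HasCompactSupport ξ → tsupport ξ ⊆ disc →
    HasDerivAt (fun t : ℝ => energy (fun x => f x + t • ξ x)) 0 0

end Patch

end WillmoreConservation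

end

/-!
The identity `⋆(⋆(u ∧ v) ∧ w) = ⟨u, w⟩ v - ⟨v, w⟩ u` turns the Gauss map term of the conserved form
into a term in the second fundamental form, and the form becomes
`-2 π_n(dH) + 2 (|H|² df - ∑ g^{kl} h_{ik} ∂_l f)` with `h_{ij} = ⟨H, 𝕀(∂_i, ∂_j)⟩`. The normal part
of its codifferential is the Willmore operator, and its tangential part vanishes by the Codazzi
equation.

The derivative of `|H|² √(det g)` along a variation `ξ` with compact support differs from
`½ ⟨ξ, d^{*_g} C⟩ √(det g)`, where `C` is the conserved form, by the flat divergence of a field with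
compact support. Hence the Willmore surfaces are those with `d^{*_g} C = 0`. In conformal
coordinates `√(det g) g^{ij} = δ_{ij}`, so that `√(det g) d^{*_g} C` is minus a flat divergence.
-/

noncomputable section

namespace WillmoreConservation

/-! ### Double Hodge dual of a bivector -/

section Multivectors

variable {m : ℕ}

lemma toVec_toMulti (v : Amb m) : toVec (toMulti v) = v :=
  ExteriorAlgebra.ι_leftInverse (R := ℝ) (M := Amb m) v

lemma toMulti_mul_swap (u v : Amb m) : toMulti u * toMulti v = -(toMulti v * toMulti u) :=
  eq_neg_of_add_eq_zero_left (ExteriorAlgebra.ι_add_mul_swap u v)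

lemma commute_toMulti_mul_toMulti (u v : Amb m) (a : Multivec m) :
    Commute (toMulti u * toMulti v) a := by
  induction a using ExteriorAlgebra.induction with
  | algebraMap r => exact Algebra.commute_algebraMap_right r _
  | ι w =>
    change toMulti u * toMulti v * toMulti w = toMulti w * (toMulti u * toMulti v)
    rw [mul_assoc, toMulti_mul_swap v w, mul_neg, ← mul_assoc, toMulti_mul_swap u w, neg_mul,
      neg_neg, mul_assoc]
  | mul a b ha hb => exact ha.mul_right hb
  | add a b ha hb => exact ha.add_right hb

lemma multiBasis_singleton (i : Fin m) :
    multiBasis m {i} = toMulti (EuclideanSpace.single i 1) := by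
  have h := ExteriorAlgebra.basis_apply_ofCard (R := ℝ)
    (EuclideanSpace.basisFun (Fin m) ℝ).toBasis (Finset.card_singleton i)
  rw [multiBasis, h, ExteriorAlgebra.ιMulti_family, ExteriorAlgebra.ιMulti_apply]
  simp [toMulti, Set.powersetCard.ofFinEmbEquiv_symm_apply, Set.powersetCard.ofCard]

lemma exists_multiBasis_mul_of_disjoint {S T : Finset (Fin m)} (h : Disjoint S T) :
    ∃ s : ℝ, s * s = 1 ∧ multiBasis m S * multiBasis m T = s • multiBasis m (S ∪ T) := by
  let S' := Set.powersetCard.ofCard (rfl : S.card = S.card)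
  let T' := Set.powersetCard.ofCard (rfl : T.card = T.card)
  have hmul := ExteriorAlgebra.basis_mul_of_disjoint (R := ℝ)
    (EuclideanSpace.basisFun (Fin m) ℝ).toBasis S' T' h
  have hunion : (Set.powersetCard.disjUnion (s := S') (t := T') h).val = S ∪ T :=
    Finset.disjUnion_eq_union S T h
  rw [hunion] at hmul
  let σ := Equiv.Perm.sign (Set.powersetCard.permOfDisjoint (s := S') (t := T') h)
  refine ⟨((σ : ℤ) : ℝ), ?_, hmul.trans ?_⟩
  · rcases Int.units_eq_one_or σ with hσ | hσ <;> simp [hσ]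
  · rcases Int.units_eq_one_or σ with hσ | hσ <;> simp [σ, hσ, multiBasis]

lemma multiBasis_mul_of_not_disjoint {S T : Finset (Fin m)} (h : ¬Disjoint S T) :
    multiBasis m S * multiBasis m T = 0 :=
  ExteriorAlgebra.basis_mul_of_not_disjoint (R := ℝ)
    (EuclideanSpace.basisFun (Fin m) ℝ).toBasis
    (Set.powersetCard.ofCard (rfl : S.card = S.card))
    (Set.powersetCard.ofCard (rfl : T.card = T.card)) h

lemma hodge_multiBasis (S : Finset (Fin m)) :
    hodge m (multiBasis m S) =
      (multiBasis m).repr (multiBasis m S * multiBasis m Sᶜ) Finset.univ • multiBasis m Sᶜ :=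
  (multiBasis m).constr_basis ℝ _ _

lemma multiBasis_mul_hodge_multiBasis (S : Finset (Fin m)) :
    multiBasis m S * hodge m (multiBasis m S) = multiBasis m Finset.univ := by
  obtain ⟨s, hs, hS⟩ := exists_multiBasis_mul_of_disjoint (disjoint_compl_right (a := S))
  rw [Finset.union_compl] at hS
  rw [hodge_multiBasis, mul_smul_comm, hS]
  simp [smul_smul, hs]

lemma hodge_smul_multiBasis_compl {S : Finset (Fin m)} {r : ℝ}
    (h : r • (multiBasis m Sᶜ * multiBasis m S) = multiBasis m Finset.univ) :
    hodge m (r • multiBasis m Sᶜ) = multiBasis m S := by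
  have hr : r * (multiBasis m).repr (multiBasis m Sᶜ * multiBasis m S) Finset.univ = 1 := by
    simpa using congrArg (fun a => (multiBasis m).repr a Finset.univ) h
  rw [map_smul, hodge_multiBasis, compl_compl, smul_smul, hr, one_smul]

lemma hodge_hodge_single_left {i j : Fin m} (hij : i ≠ j) :
    hodge m (hodge m (toMulti (EuclideanSpace.single i 1) * toMulti (EuclideanSpace.single j 1))
      * toMulti (EuclideanSpace.single i 1)) = toMulti (EuclideanSpace.single j 1) := by
  have hcomm := commute_toMulti_mul_toMulti (EuclideanSpace.single i 1) (EuclideanSpace.single j 1)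
  simp only [← multiBasis_singleton] at hcomm ⊢
  obtain ⟨s, hs, hS⟩ :=
    exists_multiBasis_mul_of_disjoint (Finset.disjoint_singleton.2 hij)
  have hunit : multiBasis m {i} * multiBasis m {j} * hodge m (multiBasis m {i} * multiBasis m {j})
      = multiBasis m Finset.univ := by
    rw [hS, map_smul, smul_mul_smul_comm, hs, one_smul, multiBasis_mul_hodge_multiBasis]
  obtain ⟨t, -, hT⟩ := exists_multiBasis_mul_of_disjoint
    (S := ({i} ∪ {j} : Finset (Fin m))ᶜ) (T := {i}) (by simp)
  have hcompl : ({i} ∪ {j} : Finset (Fin m))ᶜ ∪ {i} = {j}ᶜ := by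
    ext k; simp only [Finset.mem_compl, Finset.mem_union, Finset.mem_singleton]; grind
  obtain ⟨r, hr⟩ : ∃ r : ℝ, hodge m (multiBasis m {i} * multiBasis m {j}) * multiBasis m {i}
      = r • multiBasis m {j}ᶜ := by
    rw [hS, map_smul, hodge_multiBasis, smul_mul_assoc, smul_mul_assoc, hT, hcompl, smul_smul,
      smul_smul]
    exact ⟨_, rfl⟩
  rw [hr]
  refine hodge_smul_multiBasis_compl ?_
  rw [← smul_mul_assoc, ← hr, mul_assoc, ← (hcomm _).eq, hunit]

lemma hodge_hodge_single (i j k : Fin m) :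
    toVec (hodge m (hodge m
      (toMulti (EuclideanSpace.single i 1) * toMulti (EuclideanSpace.single j 1))
      * toMulti (EuclideanSpace.single k 1))) =
    inner ℝ (EuclideanSpace.single i (1 : ℝ)) (EuclideanSpace.single k (1 : ℝ)) •
        EuclideanSpace.single j (1 : ℝ)
      - inner ℝ (EuclideanSpace.single j (1 : ℝ)) (EuclideanSpace.single k (1 : ℝ)) •
        EuclideanSpace.single i (1 : ℝ) := by
  rcases eq_or_ne i j with rfl | hij
  · simp [toMulti, toVec]
  rcases eq_or_ne k i with rfl | hki
  · rw [hodge_hodge_single_left hij, toVec_toMulti]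
    simp [EuclideanSpace.inner_single_left, hij]
  rcases eq_or_ne k j with rfl | hkj
  · rw [toMulti_mul_swap, map_neg, neg_mul, map_neg, hodge_hodge_single_left hij.symm, toVec,
      map_neg, ← toVec, toVec_toMulti]
    simp [EuclideanSpace.inner_single_left, hij]
  · obtain ⟨s, -, hS⟩ := exists_multiBasis_mul_of_disjoint (Finset.disjoint_singleton.2 hij)
    simp only [← multiBasis_singleton]
    rw [hS, map_smul, hodge_multiBasis, smul_mul_assoc, smul_mul_assoc,
      multiBasis_mul_of_not_disjoint (S := ({i} ∪ {j})ᶜ) (T := {k}) (by simp [hki, hkj])]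
    simp [toVec, EuclideanSpace.inner_single_left, hki.symm, hkj.symm]

lemma isLinearMap_eq_of_eq_single {F G : Amb m → Amb m} (hF : IsLinearMap ℝ F)
    (hG : IsLinearMap ℝ G)
    (h : ∀ i, F (EuclideanSpace.single i 1) = G (EuclideanSpace.single i 1)) (v : Amb m) :
    F v = G v := by
  have : hF.mk' F = hG.mk' G :=
    (EuclideanSpace.basisFun (Fin m) ℝ).toBasis.ext fun i => by simpa using h i
  exact LinearMap.congr_fun this v

lemma toVec_hodge_hodge_mul (u v w : Amb m) :
    toVec (hodge m (hodge m (toMulti u * toMulti v) * toMulti w)) =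
      (inner ℝ u w : ℝ) • v - (inner ℝ v w : ℝ) • u := by
  refine isLinearMap_eq_of_eq_single
    (F := fun u => toVec (hodge m (hodge m (toMulti u * toMulti v) * toMulti w)))
    (G := fun u => (inner ℝ u w : ℝ) • v - (inner ℝ v w : ℝ) • u) ?_ ?_ (fun i => ?_) u
  · constructor <;> intros <;> simp [toMulti, toVec, add_mul]
  · constructor <;> intros <;> simp only [inner_add_left, real_inner_smul_left] <;> module
  refine isLinearMap_eq_of_eq_single (F := fun v => toVec (hodge m (hodge m
    (toMulti (EuclideanSpace.single i 1) * toMulti v) * toMulti w)))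
    (G := fun v => (inner ℝ (EuclideanSpace.single i (1 : ℝ)) w : ℝ) • v
      - (inner ℝ v w : ℝ) • EuclideanSpace.single i (1 : ℝ)) ?_ ?_ (fun j => ?_) v
  · constructor <;> intros <;> simp [toMulti, toVec, mul_add, add_mul]
  · constructor <;> intros <;> simp only [inner_add_left, real_inner_smul_left] <;> module
  refine isLinearMap_eq_of_eq_single (F := fun w => toVec (hodge m (hodge m
    (toMulti (EuclideanSpace.single i 1) * toMulti (EuclideanSpace.single j 1)) * toMulti w)))
    (G := fun w => (inner ℝ (EuclideanSpace.single i (1 : ℝ)) w : ℝ) •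
        EuclideanSpace.single j (1 : ℝ)
      - (inner ℝ (EuclideanSpace.single j (1 : ℝ)) w : ℝ) • EuclideanSpace.single i (1 : ℝ)) ?_ ?_
    (hodge_hodge_single i j) w
  · constructor <;> intros <;> simp [toMulti, toVec, mul_add]
  · constructor <;> intros <;> simp only [inner_add_right, real_inner_smul_right] <;> module

end Multivectors

/-! ### Partial derivatives -/

section PartialDerivatives

variable {W : Type*} [NormedAddCommGroup W] [NormedSpace ℝ W] {x : Plane} {i : Fin 2}

lemma pd_add {u v : Plane → W} (hu : DifferentiableAt ℝ u x) (hv : DifferentiableAt ℝ v x) :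
    pd i (fun y => u y + v y) x = pd i u x + pd i v x := by
  simp only [pd]; rw [fderiv_fun_add hu hv]; rfl

lemma pd_sub {u v : Plane → W} (hu : DifferentiableAt ℝ u x) (hv : DifferentiableAt ℝ v x) :
    pd i (fun y => u y - v y) x = pd i u x - pd i v x := by
  simp only [pd]; rw [fderiv_fun_sub hu hv]; rfl

lemma pd_neg (u : Plane → W) : pd i (fun y => -u y) x = -pd i u x := by
  simp only [pd]; rw [fderiv_fun_neg]; rfl

lemma pd_const (c : W) : pd i (fun _ => c) x = 0 := by
  simp [pd]

lemma pd_sum {ι : Type*} {s : Finset ι} {u : ι → Plane → W}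
    (hu : ∀ k ∈ s, DifferentiableAt ℝ (u k) x) :
    pd i (fun y => ∑ k ∈ s, u k y) x = ∑ k ∈ s, pd i (u k) x := by
  simp only [pd]; rw [fderiv_fun_sum hu, sum_apply]

lemma pd_smul {r : Plane → ℝ} {u : Plane → W} (hr : DifferentiableAt ℝ r x)
    (hu : DifferentiableAt ℝ u x) :
    pd i (fun y => r y • u y) x = pd i r x • u x + r x • pd i u x := by
  simp only [pd]; rw [fderiv_fun_smul hr hu]; simp [add_comm]

lemma pd_const_smul (r : ℝ) {u : Plane → W} (hu : DifferentiableAt ℝ u x) :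
    pd i (fun y => r • u y) x = r • pd i u x := by
  simp only [pd]; rw [fderiv_fun_const_smul hu]; rfl

lemma pd_mul {r s : Plane → ℝ} (hr : DifferentiableAt ℝ r x) (hs : DifferentiableAt ℝ s x) :
    pd i (fun y => r y * s y) x = pd i r x * s x + r x * pd i s x :=
  pd_smul hr hs

lemma pd_inner {E : Type*} [NormedAddCommGroup E] [InnerProductSpace ℝ E] {u v : Plane → E}
    (hu : DifferentiableAt ℝ u x) (hv : DifferentiableAt ℝ v x) :
    pd i (fun y => (inner ℝ (u y) (v y) : ℝ)) x =
      inner ℝ (pd i u x) (v x) + inner ℝ (u x) (pd i v x) := by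
  simp only [pd]; rw [fderiv_inner_apply ℝ hu hv, add_comm]

lemma pd_congr {u v : Plane → W} {U : Set Plane} (hU : IsOpen U) (hx : x ∈ U)
    (h : Set.EqOn u v U) : pd i u x = pd i v x := by
  rw [pd, pd, (Filter.eventuallyEq_of_mem (hU.mem_nhds hx) h).fderiv_eq]

lemma hasDerivAt_comp_add_smul_coordVec {u : Plane → W} (hu : DifferentiableAt ℝ u x) (i : Fin 2) :
    HasDerivAt (fun t : ℝ => u (x + t • coordVec i)) (pd i u x) 0 :=
  hu.hasFDerivAt.hasLineDerivAt (coordVec i)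

lemma contDiffOn_pd {u : Plane → W} {U : Set Plane} (hU : IsOpen U) (hu : ContDiffOn ℝ ∞ u U)
    (i : Fin 2) : ContDiffOn ℝ ∞ (pd i u) U :=
  (hu.fderiv_of_isOpen hU (by simp)).clm_apply contDiffOn_const

lemma pd_pd_eq {u : Plane → W} {U : Set Plane} (hU : IsOpen U) (hu : ContDiffOn ℝ ∞ u U)
    (hx : x ∈ U) (i j : Fin 2) :
    pd i (pd j u) x = fderiv ℝ (fderiv ℝ u) x (coordVec i) (coordVec j) := by
  have h : DifferentiableAt ℝ (fderiv ℝ u) x :=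
    ((hu.fderiv_of_isOpen hU (m := ∞) (by simp)).contDiffAt (hU.mem_nhds hx)).differentiableAt
      (by simp)
  change fderiv ℝ (fun y => fderiv ℝ u y (coordVec j)) x (coordVec i) = _
  rw [fderiv_clm_apply h (differentiableAt_const _)]
  simp

lemma pd_comm {u : Plane → W} {U : Set Plane} (hU : IsOpen U) (hu : ContDiffOn ℝ ∞ u U)
    (hx : x ∈ U) (i j : Fin 2) : pd i (pd j u) x = pd j (pd i u) x := by
  have hsymm : IsSymmSndFDerivAt ℝ u x :=
    (hu.contDiffAt (hU.mem_nhds hx)).isSymmSndFDerivAt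
      (by rw [minSmoothness_of_isRCLikeNormedField]; exact WithTop.coe_le_coe.2 le_top)
  rw [pd_pd_eq hU hu hx, pd_pd_eq hU hu hx, hsymm.eq]

lemma plane_eq_sum (X : Plane) : X = ∑ i, X i • coordVec i := by
  ext k; fin_cases k <;> simp [coordVec]

lemma fderiv_apply_eq (u : Plane → W) (x X : Plane) :
    fderiv ℝ u x X = ∑ i, X i • pd i u x := by
  conv_lhs => rw [plane_eq_sum X]
  simp [pd]

end PartialDerivatives

/-! ### Determinants and inverses of matrices depending on a parameter -/

section MatrixCalculus

variable {ι : Type*} [Fintype ι] [DecidableEq ι]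

lemma contDiffAt_matrix_det {X : Type*} [NormedAddCommGroup X] [NormedSpace ℝ X] {k : WithTop ℕ∞}
    {p : X} {A : X → Matrix ι ι ℝ} (hA : ∀ i j, ContDiffAt ℝ k (fun y => A y i j) p) :
    ContDiffAt ℝ k (fun y => (A y).det) p := by
  simp only [Matrix.det_apply']
  exact ContDiffAt.sum fun σ _ => contDiffAt_const.mul (contDiffAt_prod fun i _ => hA _ _)

lemma contDiffAt_matrix_inv_apply {X : Type*} [NormedAddCommGroup X] [NormedSpace ℝ X]
    {k : WithTop ℕ∞} {p : X} {A : X → Matrix ι ι ℝ}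
    (hA : ∀ i j, ContDiffAt ℝ k (fun y => A y i j) p) (h : (A p).det ≠ 0) (i j : ι) :
    ContDiffAt ℝ k (fun y => (A y)⁻¹ i j) p := by
  simp only [Matrix.inv_def, Ring.inverse_eq_inv', Matrix.smul_apply, smul_eq_mul,
    Matrix.adjugate_apply]
  refine ((contDiffAt_matrix_det hA).inv h).mul (contDiffAt_matrix_det fun r c => ?_)
  by_cases hr : r = j
  · simpa [hr] using contDiffAt_const
  · simpa [Matrix.updateRow_apply, hr] using hA r c

variable {A : ℝ → Matrix ι ι ℝ} {A' : Matrix ι ι ℝ} {t : ℝ}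

open scoped Matrix.Norms.Operator in
lemma hasDerivAt_matrix_inv_apply (hA : ∀ i j, HasDerivAt (fun s => A s i j) (A' i j) t)
    (h : (A t).det ≠ 0) (i j : ι) :
    HasDerivAt (fun s => (A s)⁻¹ i j) (-((A t)⁻¹ * A' * (A t)⁻¹) i j) t := by
  have hA' : HasDerivAt A A' t := hasDerivAt_pi.2 fun i => hasDerivAt_pi.2 fun j => hA i j
  obtain ⟨u, hu⟩ := (Matrix.isUnit_iff_isUnit_det _).2 (isUnit_iff_ne_zero.2 h)
  have hinv : HasFDerivAt Ring.inverse _ (A t) := hu ▸ hasFDerivAt_ringInverse (𝕜 := ℝ) u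
  have hentry := hasDerivAt_pi.1 (hasDerivAt_pi.1 (hinv.comp_hasDerivAt t hA') i) j
  simpa [Function.comp_def, ← Matrix.nonsing_inv_eq_ringInverse, hu] using hentry

/- The determinant is multilinear in the rows, so its differential at `A` replaces one row at a
time; by Cramer's rule the sum of these determinants is the trace of `adj A * A'`. -/
lemma hasDerivAt_matrix_det (hA : ∀ i j, HasDerivAt (fun s => A s i j) (A' i j) t) :
    HasDerivAt (fun s => (A s).det) ((A t).adjugate * A').trace t := by
  let D : ContinuousMultilinearMap ℝ (fun _ : ι => ι → ℝ) ℝ :=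
    ⟨Matrix.detRowAlternating.toMultilinearMap, continuous_id.matrix_det⟩
  have hrows : HasDerivAt (fun s i => A s i) (fun i => A' i) t :=
    hasDerivAt_pi.2 fun i => hasDerivAt_pi.2 fun j => hA i j
  refine ((D.hasFDerivAt (A t)).comp_hasDerivAt t hrows).congr_deriv ?_
  refine (D.linearDeriv_apply _ _).trans ?_
  rw [Matrix.trace_mul_comm]
  refine Finset.sum_congr rfl fun i _ => ?_
  change ((A t).updateRow i (A' i)).det = _
  rw [← Matrix.cramer_transpose_apply, Matrix.cramer_eq_adjugate_mulVec,
    ← Matrix.adjugate_transpose]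
  simp [Matrix.mulVec, dotProduct, Matrix.mul_apply, mul_comm]

end MatrixCalculus

/-! ### Normal components and mean curvature as functions of the derivatives -/

section Jets

variable {ι E : Type*} [Fintype ι] [DecidableEq ι] [NormedAddCommGroup E] [InnerProductSpace ℝ E]

/-- The component of `v` orthogonal to the span of a linearly independent family `a`. The
coefficients come from the inverse Gram matrix, which makes the smooth dependence on `a` visible. -/
def normalPart (a : ι → E) (v : E) : E :=
  v - ∑ k, ∑ l, ((Matrix.gram ℝ a)⁻¹ k l * inner ℝ (a k) v) • a l

lemma gram_inv_symm (a : ι → E) (i j : ι) :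
    (Matrix.gram ℝ a)⁻¹ i j = (Matrix.gram ℝ a)⁻¹ j i := by
  simpa using ((Matrix.isHermitian_gram ℝ a).inv.apply i j).symm

lemma sum_gram_inv_mul_inner {a : ι → E} (h : (Matrix.gram ℝ a).det ≠ 0) (i j : ι) :
    ∑ k, (Matrix.gram ℝ a)⁻¹ i k * inner ℝ (a k) (a j) = if i = j then 1 else 0 := by
  simpa [Matrix.mul_apply, Matrix.one_apply] using
    congrFun (congrFun (Matrix.nonsing_inv_mul (Matrix.gram ℝ a) (isUnit_iff_ne_zero.2 h)) i) j

lemma inner_normalPart {a : ι → E} (h : (Matrix.gram ℝ a).det ≠ 0) (v : E) (l : ι) :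
    inner ℝ (a l) (normalPart a v) = 0 := by
  have hsum (k : ι) : ∑ j, (Matrix.gram ℝ a)⁻¹ k j * inner ℝ (a k) v * inner ℝ (a l) (a j)
      = if k = l then inner ℝ (a k) v else 0 := by
    rw [← mul_boole, ← sum_gram_inv_mul_inner h, Finset.mul_sum]
    exact Finset.sum_congr rfl fun j _ => by rw [real_inner_comm (a j)]; ring
  simp [normalPart, inner_sub_right, inner_sum, real_inner_smul_right, hsum]

section Smooth

variable {X : Type*} [NormedAddCommGroup X] [NormedSpace ℝ X] {n : WithTop ℕ∞} {p : X}

lemma contDiffAt_gram_inv {a : ι → X → E} (ha : ∀ i, ContDiffAt ℝ n (a i) p)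
    (h : (Matrix.gram ℝ fun k => a k p).det ≠ 0) (i j : ι) :
    ContDiffAt ℝ n (fun y => (Matrix.gram ℝ fun k => a k y)⁻¹ i j) p :=
  contDiffAt_matrix_inv_apply (fun i j => (ha i).inner ℝ (ha j)) h i j

lemma contDiffAt_sqrt_det_gram {a : ι → X → E} (ha : ∀ i, ContDiffAt ℝ n (a i) p)
    (h : (Matrix.gram ℝ fun k => a k p).det ≠ 0) :
    ContDiffAt ℝ n (fun y => √(Matrix.gram ℝ fun k => a k y).det) p :=
  (contDiffAt_matrix_det fun i j => (ha i).inner ℝ (ha j)).sqrt h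

lemma contDiffAt_normalPart {a : ι → X → E} (ha : ∀ i, ContDiffAt ℝ n (a i) p)
    (h : (Matrix.gram ℝ fun k => a k p).det ≠ 0) {v : X → E} (hv : ContDiffAt ℝ n v p) :
    ContDiffAt ℝ n (fun y => normalPart (fun k => a k y) (v y)) p :=
  hv.sub <| ContDiffAt.sum fun k _ => ContDiffAt.sum fun l _ =>
    ((contDiffAt_gram_inv ha h k l).mul ((ha k).inner ℝ hv)).smul (ha l)

end Smooth

section Curves

lemma hasDerivAt_gram {κ : Type*} {a : κ → ℝ → E} {a' : κ → E} {t : ℝ}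
    (ha : ∀ i, HasDerivAt (a i) (a' i) t) (i j : κ) :
    HasDerivAt (fun s => Matrix.gram ℝ (fun k => a k s) i j)
      (inner ℝ (a i t) (a' j) + inner ℝ (a' i) (a j t)) t :=
  (ha i).inner ℝ (ha j)

variable {a : ι → ℝ → E} {a' : ι → E} {t : ℝ}

lemma hasDerivAt_gram_inv (ha : ∀ i, HasDerivAt (a i) (a' i) t)
    (h : (Matrix.gram ℝ fun k => a k t).det ≠ 0) (i j : ι) :
    HasDerivAt (fun s => (Matrix.gram ℝ fun k => a k s)⁻¹ i j)
      (-∑ q, ∑ p, (Matrix.gram ℝ fun k => a k t)⁻¹ i p *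
        (inner ℝ (a p t) (a' q) + inner ℝ (a' p) (a q t)) *
          (Matrix.gram ℝ fun k => a k t)⁻¹ q j) t := by
  refine (hasDerivAt_matrix_inv_apply (A' := Matrix.of fun p q =>
    inner ℝ (a p t) (a' q) + inner ℝ (a' p) (a q t)) (hasDerivAt_gram ha) h i j).congr_deriv ?_
  simp [Matrix.mul_apply, Finset.sum_mul]

lemma hasDerivAt_sqrt_det_gram (ha : ∀ i, HasDerivAt (a i) (a' i) t)
    (h : (Matrix.gram ℝ fun k => a k t).det ≠ 0) :
    HasDerivAt (fun s => √(Matrix.gram ℝ fun k => a k s).det)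
      (√(Matrix.gram ℝ fun k => a k t).det *
        ∑ i, ∑ j, (Matrix.gram ℝ fun k => a k t)⁻¹ i j * inner ℝ (a i t) (a' j)) t := by
  set G := Matrix.gram ℝ fun k => a k t with hG
  have hpos : 0 < G.det := (Matrix.posSemidef_gram ℝ _).det_nonneg.lt_of_ne' h
  have hadj : G.adjugate = G.det • G⁻¹ := by
    rw [Matrix.inv_def, Ring.inverse_eq_inv', smul_smul, mul_inv_cancel₀ h, one_smul]
  have hdet := hasDerivAt_matrix_det (A' := Matrix.of fun i j =>
    inner ℝ (a i t) (a' j) + inner ℝ (a' i) (a j t)) (hasDerivAt_gram ha)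
  have htrace : (G.adjugate * Matrix.of fun i j =>
      inner ℝ (a i t) (a' j) + inner ℝ (a' i) (a j t)).trace
      = 2 * G.det * ∑ i, ∑ j, G⁻¹ i j * inner ℝ (a i t) (a' j) := by
    have hswap : ∑ i, ∑ j, G⁻¹ i j * inner ℝ (a j t) (a' i)
        = ∑ i, ∑ j, G⁻¹ i j * inner ℝ (a i t) (a' j) := by
      rw [Finset.sum_comm]
      exact Finset.sum_congr rfl fun i _ => Finset.sum_congr rfl fun j _ => by
        rw [hG, gram_inv_symm _ j i]
    rw [hadj, Matrix.smul_mul, Matrix.trace_smul, Matrix.trace, smul_eq_mul]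
    simp only [Matrix.diag_apply, Matrix.mul_apply, Matrix.of_apply, mul_add,
      Finset.sum_add_distrib, real_inner_comm _ (a' _)]
    rw [hswap]
    ring
  refine (hdet.sqrt h).congr_deriv ?_
  rw [← hG, htrace, div_eq_iff (by positivity)]
  linear_combination (-2) * (∑ i, ∑ j, G⁻¹ i j * inner ℝ (a i t) (a' j)) *
    Real.mul_self_sqrt hpos.le

lemma hasDerivAt_inner_normalPart (ha : ∀ i, HasDerivAt (a i) (a' i) t)
    (h : (Matrix.gram ℝ fun k => a k t).det ≠ 0) {v : ℝ → E} {v' : E} (hv : HasDerivAt v v' t)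
    {N : E} (hN : ∀ i, inner ℝ N (a i t) = 0) :
    HasDerivAt (fun s => inner ℝ N (normalPart (fun k => a k s) (v s)))
      (inner ℝ N (v' - ∑ k, ∑ l,
        ((Matrix.gram ℝ fun k => a k t)⁻¹ k l * inner ℝ (a k t) (v t)) • a' l)) t := by
  have hvN : HasDerivAt (fun s => inner ℝ N (v s)) (inner ℝ N v') t := by
    simpa using (hasDerivAt_const t N).inner ℝ hv
  have hterm (k l : ι) : HasDerivAt
      (fun s => (Matrix.gram ℝ fun k => a k s)⁻¹ k l * inner ℝ (a k s) (v s) * inner ℝ N (a l s))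
      ((Matrix.gram ℝ fun k => a k t)⁻¹ k l * inner ℝ (a k t) (v t) * inner ℝ N (a' l)) t := by
    have haN : HasDerivAt (fun s => inner ℝ N (a l s)) (inner ℝ N (a' l)) t := by
      simpa using (hasDerivAt_const t N).inner ℝ (ha l)
    refine (((hasDerivAt_gram_inv ha h k l).mul ((ha k).inner ℝ hv)).mul haN).congr_deriv ?_
    rw [hN, mul_zero, zero_add]
    rfl
  have hsum := hvN.fun_sub (HasDerivAt.fun_sum (u := Finset.univ) fun k _ =>
    HasDerivAt.fun_sum (u := Finset.univ) fun l _ => hterm k l)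
  simpa only [normalPart, inner_sub_right, inner_sum, real_inner_smul_right] using hsum

end Curves

end Jets

section JetMeanCurvature

variable {E : Type*} [NormedAddCommGroup E] [InnerProductSpace ℝ E]

/-- The mean curvature vector of an immersion with first derivatives `a i` and second derivatives
`b i j`. -/
def jetMeanCurv (a : Fin 2 → E) (b : Fin 2 → Fin 2 → E) : E :=
  (1 / 2 : ℝ) • ∑ i, ∑ j, (Matrix.gram ℝ a)⁻¹ i j • normalPart a (b i j)

/-- The integrand `|H|² √(det g)` of the Willmore energy of an immersion with first derivatives
`a i` and second derivatives `b i j`. -/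
def jetWillmoreDensity (a : Fin 2 → E) (b : Fin 2 → Fin 2 → E) : ℝ :=
  ‖jetMeanCurv a b‖ ^ 2 * √(Matrix.gram ℝ a).det

lemma inner_jetMeanCurv {a : Fin 2 → E} (h : (Matrix.gram ℝ a).det ≠ 0)
    (b : Fin 2 → Fin 2 → E) (l : Fin 2) : inner ℝ (jetMeanCurv a b) (a l) = 0 := by
  rw [real_inner_comm]
  simp only [jetMeanCurv, inner_sum, real_inner_smul_right, inner_normalPart h, mul_zero,
    Finset.sum_const_zero]

section Smooth

variable {X : Type*} [NormedAddCommGroup X] [NormedSpace ℝ X] {n : WithTop ℕ∞} {p : X}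
  {a : Fin 2 → X → E} {b : Fin 2 → Fin 2 → X → E}

lemma contDiffAt_jetMeanCurv (ha : ∀ i, ContDiffAt ℝ n (a i) p)
    (hb : ∀ i j, ContDiffAt ℝ n (b i j) p) (h : (Matrix.gram ℝ fun k => a k p).det ≠ 0) :
    ContDiffAt ℝ n (fun y => jetMeanCurv (fun k => a k y) fun i j => b i j y) p :=
  contDiffAt_const.smul <| ContDiffAt.sum fun i _ => ContDiffAt.sum fun j _ =>
    (contDiffAt_gram_inv ha h i j).smul (contDiffAt_normalPart ha h (hb i j))

lemma contDiffAt_jetWillmoreDensity (ha : ∀ i, ContDiffAt ℝ n (a i) p)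
    (hb : ∀ i j, ContDiffAt ℝ n (b i j) p) (h : (Matrix.gram ℝ fun k => a k p).det ≠ 0) :
    ContDiffAt ℝ n (fun y => jetWillmoreDensity (fun k => a k y) fun i j => b i j y) p :=
  ((contDiffAt_jetMeanCurv ha hb h).norm_sq ℝ).mul (contDiffAt_sqrt_det_gram ha h)

end Smooth

section FirstVariation

variable {a : Fin 2 → ℝ → E} {b : Fin 2 → Fin 2 → ℝ → E} {a' : Fin 2 → E} {b' : Fin 2 → Fin 2 → E}
  {t : ℝ}

/- In `d|H|² = 2⟨H, dH⟩` the vector `H` is frozen at time `t`, where it is normal, so that only the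
derivatives of the tangent vectors in `normalPart` contribute. -/
lemma hasDerivAt_norm_sq_jetMeanCurv (ha : ∀ i, HasDerivAt (a i) (a' i) t)
    (hb : ∀ i j, HasDerivAt (b i j) (b' i j) t) (h : (Matrix.gram ℝ fun k => a k t).det ≠ 0)
    (hsmooth : DifferentiableAt ℝ (fun s => jetMeanCurv (fun k => a k s) fun i j => b i j s) t) :
    HasDerivAt (fun s => ‖jetMeanCurv (fun k => a k s) fun i j => b i j s‖ ^ 2)
      (∑ i, ∑ j, (Matrix.gram ℝ fun k => a k t)⁻¹ i j *
          inner ℝ (jetMeanCurv (fun k => a k t) fun i j => b i j t) (b' i j - ∑ k, ∑ l,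
            ((Matrix.gram ℝ fun k => a k t)⁻¹ k l * inner ℝ (a k t) (b i j t)) • a' l)
        - ∑ i, ∑ j, (∑ q, ∑ p, (Matrix.gram ℝ fun k => a k t)⁻¹ i p *
          (inner ℝ (a p t) (a' q) + inner ℝ (a' p) (a q t)) *
            (Matrix.gram ℝ fun k => a k t)⁻¹ q j) *
          inner ℝ (jetMeanCurv (fun k => a k t) fun i j => b i j t) (b i j t)) t := by
  set H := fun s => jetMeanCurv (fun k => a k s) fun i j => b i j s with hH
  set G := fun s => (Matrix.gram ℝ fun k => a k s)⁻¹ with hG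
  have hN (k : Fin 2) : inner ℝ (H t) (a k t) = 0 := inner_jetMeanCurv h _ k
  have hnormal (v : E) : inner ℝ (H t) (normalPart (fun k => a k t) v) = inner ℝ (H t) v := by
    simp only [normalPart, inner_sub_right, inner_sum, real_inner_smul_right, hN, mul_zero,
      Finset.sum_const_zero, sub_zero]
  have hfrozen (s : ℝ) : inner ℝ (H t) (H s) = 1 / 2 * ∑ i, ∑ j, G s i j *
      inner ℝ (H t) (normalPart (fun k => a k s) (b i j s)) := by
    simp only [hH, hG, jetMeanCurv, inner_sum, real_inner_smul_right]
  have hterm (i j : Fin 2) := (hasDerivAt_gram_inv ha h i j).mul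
    (hasDerivAt_inner_normalPart ha h (hb i j) hN)
  have hderiv := ((HasDerivAt.fun_sum (u := Finset.univ) fun i _ =>
    HasDerivAt.fun_sum (u := Finset.univ) fun j _ => hterm i j).const_mul (1 / 2 : ℝ))
  have huniq := hderiv.unique ((((hasDerivAt_const t (H t)).inner ℝ
    hsmooth.hasDerivAt)).congr_of_eventuallyEq (.of_forall fun s => (hfrozen s).symm))
  refine hsmooth.hasDerivAt.norm_sq.congr_deriv ?_
  rw [inner_zero_left, add_zero] at huniq
  rw [← huniq]
  simp only [hnormal, neg_mul, Finset.sum_add_distrib, Finset.sum_neg_distrib]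
  ring

lemma hasDerivAt_jetWillmoreDensity (ha : ∀ i, HasDerivAt (a i) (a' i) t)
    (hb : ∀ i j, HasDerivAt (b i j) (b' i j) t) (h : (Matrix.gram ℝ fun k => a k t).det ≠ 0)
    (hsmooth : DifferentiableAt ℝ (fun s => jetMeanCurv (fun k => a k s) fun i j => b i j s) t) :
    HasDerivAt (fun s => jetWillmoreDensity (fun k => a k s) fun i j => b i j s)
      (√(Matrix.gram ℝ fun k => a k t).det *
        (∑ i, ∑ j, (Matrix.gram ℝ fun k => a k t)⁻¹ i j *
            inner ℝ (jetMeanCurv (fun k => a k t) fun i j => b i j t) (b' i j - ∑ k, ∑ l,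
              ((Matrix.gram ℝ fun k => a k t)⁻¹ k l * inner ℝ (a k t) (b i j t)) • a' l)
          - ∑ i, ∑ j, (∑ q, ∑ p, (Matrix.gram ℝ fun k => a k t)⁻¹ i p *
            (inner ℝ (a p t) (a' q) + inner ℝ (a' p) (a q t)) *
              (Matrix.gram ℝ fun k => a k t)⁻¹ q j) *
            inner ℝ (jetMeanCurv (fun k => a k t) fun i j => b i j t) (b i j t)
          + ‖jetMeanCurv (fun k => a k t) fun i j => b i j t‖ ^ 2 *
            ∑ i, ∑ j, (Matrix.gram ℝ fun k => a k t)⁻¹ i j * inner ℝ (a i t) (a' j))) t := by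
  refine ((hasDerivAt_norm_sq_jetMeanCurv ha hb h hsmooth).mul
    (hasDerivAt_sqrt_det_gram ha h)).congr_deriv ?_
  ring

lemma hasDerivAt_jetWillmoreDensity_add_smul {a : Fin 2 → E} (h : (Matrix.gram ℝ a).det ≠ 0)
    (a' : Fin 2 → E) (b b' : Fin 2 → Fin 2 → E) :
    HasDerivAt
      (fun s : ℝ => jetWillmoreDensity (fun k => a k + s • a' k) fun i j => b i j + s • b' i j)
      (√(Matrix.gram ℝ a).det *
        (∑ i, ∑ j, (Matrix.gram ℝ a)⁻¹ i j * inner ℝ (jetMeanCurv a b)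
            (b' i j - ∑ k, ∑ l, ((Matrix.gram ℝ a)⁻¹ k l * inner ℝ (a k) (b i j)) • a' l)
          - ∑ i, ∑ j, (∑ q, ∑ p, (Matrix.gram ℝ a)⁻¹ i p *
            (inner ℝ (a p) (a' q) + inner ℝ (a' p) (a q)) * (Matrix.gram ℝ a)⁻¹ q j) *
            inner ℝ (jetMeanCurv a b) (b i j)
          + ‖jetMeanCurv a b‖ ^ 2 *
            ∑ i, ∑ j, (Matrix.gram ℝ a)⁻¹ i j * inner ℝ (a i) (a' j))) 0 := by
  have hline (v w : E) : HasDerivAt (fun s : ℝ => v + s • w) w 0 := by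
    simpa using ((hasDerivAt_id (0 : ℝ)).smul_const w).const_add v
  have hsmooth (v w : E) : ContDiffAt ℝ 1 (fun s : ℝ => v + s • w) 0 := by fun_prop
  have h0 : (Matrix.gram ℝ fun k => a k + (0 : ℝ) • a' k).det ≠ 0 := by simpa using h
  simpa using hasDerivAt_jetWillmoreDensity (fun k => hline (a k) (a' k))
    (fun i j => hline (b i j) (b' i j)) h0 ((contDiffAt_jetMeanCurv (fun k => hsmooth (a k) (a' k))
      (fun i j => hsmooth (b i j) (b' i j)) h0).differentiableAt one_ne_zero)

end FirstVariation

end JetMeanCurvature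

/-! ### The geometry of an immersed patch -/

section Patch

variable {m : ℕ} {f : Plane → Amb m} {U : Set Plane} {x : Plane}

/-- `f` is a smooth immersion of the open set `U`: a surface read in a chart with image `U`. -/
structure IsPatch (f : Plane → Amb m) (U : Set Plane) : Prop where
  isOpen : IsOpen U
  smooth : ContDiffOn ℝ ∞ f U
  injective : ∀ x ∈ U, Function.Injective (fderiv ℝ f x)

/-- The Christoffel symbol `Γ^k_{ij} = ∑ g^{kl} ⟨∂_i ∂_j f, ∂_l f⟩` of the induced metric. -/
def christoffel (f : Plane → Amb m) (k i j : Fin 2) (x : Plane) : ℝ :=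
  ∑ l, metricInv f x k l * inner ℝ (pd i (pd j f) x) (pd l f x)

lemma metricInv_symm (f : Plane → Amb m) (x : Plane) (i j : Fin 2) :
    metricInv f x i j = metricInv f x j i :=
  gram_inv_symm _ i j

lemma metric_det_ne_zero (h : Function.Injective (fderiv ℝ f x)) : (metric f x).det ≠ 0 := by
  have hcoord : coordVec = ⇑(EuclideanSpace.basisFun (Fin 2) ℝ).toBasis := by
    ext i; simp [coordVec]
  have hli : LinearIndependent ℝ coordVec :=
    hcoord ▸ (EuclideanSpace.basisFun (Fin 2) ℝ).toBasis.linearIndependent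
  exact Matrix.det_gram_ne_zero_iff_linearIndependent.2
    (hli.map' (fderiv ℝ f x).toLinearMap (LinearMap.ker_eq_bot.2 h))

lemma normalProj_pd (i : Fin 2) : normalProj f x (pd i f x) = 0 :=
  Submodule.starProjection_orthogonal_apply_eq_zero ⟨coordVec i, rfl⟩

lemma inner_normalProj_left (v w : Amb m) :
    inner ℝ (normalProj f x v) w = inner ℝ v (normalProj f x w) :=
  Submodule.inner_starProjection_left_eq_right _ _ _

lemma normalProj_normalProj (v : Amb m) :
    normalProj f x (normalProj f x v) = normalProj f x v :=
  Submodule.starProjection_eq_self_iff.2 (Submodule.starProjection_apply_mem _ _)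

lemma inner_normalProj_pd (v : Amb m) (i : Fin 2) :
    inner ℝ (normalProj f x v) (pd i f x) = 0 := by
  rw [inner_normalProj_left, normalProj_pd, inner_zero_right]

lemma normalProj_eq_normalPart (h : (metric f x).det ≠ 0) (v : Amb m) :
    normalProj f x v = normalPart (fun i => pd i f x) v := by
  refine Submodule.eq_starProjection_of_mem_of_inner_eq_zero ?_ fun w hw => hw _ ?_
  · rintro _ ⟨X, rfl⟩
    change inner ℝ (fderiv ℝ f x X) _ = 0
    rw [fderiv_apply_eq, sum_inner]
    exact Finset.sum_eq_zero fun i _ => by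
      rw [real_inner_smul_left, inner_normalPart h v i, mul_zero]
  · rw [normalPart, sub_sub_cancel]
    exact Submodule.sum_mem _ fun k _ => Submodule.sum_mem _ fun l _ =>
      Submodule.smul_mem _ _ ⟨coordVec l, rfl⟩

lemma normalProj_meanCurv : normalProj f x (meanCurv f x) = meanCurv f x := by
  simp only [meanCurv, map_smul, map_sum, secondForm, normalProj_normalProj]

lemma inner_meanCurv_pd (i : Fin 2) : inner ℝ (meanCurv f x) (pd i f x) = 0 := by
  rw [← normalProj_meanCurv, inner_normalProj_pd]

namespace IsPatch

variable (hf : IsPatch f U)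
include hf

lemma det_ne_zero (hx : x ∈ U) : (metric f x).det ≠ 0 :=
  metric_det_ne_zero (hf.injective x hx)

lemma contDiffAt {W : Type*} [NormedAddCommGroup W] [NormedSpace ℝ W] {u : Plane → W}
    (hu : ContDiffOn ℝ ∞ u U) (hx : x ∈ U) : ContDiffAt ℝ ∞ u x :=
  hu.contDiffAt (hf.isOpen.mem_nhds hx)

lemma differentiableAt {W : Type*} [NormedAddCommGroup W] [NormedSpace ℝ W] {u : Plane → W}
    (hu : ContDiffOn ℝ ∞ u U) (hx : x ∈ U) : DifferentiableAt ℝ u x :=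
  (hf.contDiffAt hu hx).differentiableAt (by simp)

lemma contDiffOn_pd (i : Fin 2) : ContDiffOn ℝ ∞ (pd i f) U :=
  WillmoreConservation.contDiffOn_pd hf.isOpen hf.smooth i

lemma contDiffOn_pd_pd (i j : Fin 2) : ContDiffOn ℝ ∞ (pd i (pd j f)) U :=
  WillmoreConservation.contDiffOn_pd hf.isOpen (hf.contDiffOn_pd j) i

lemma pd_comm (hx : x ∈ U) (i j : Fin 2) : pd i (pd j f) x = pd j (pd i f) x :=
  WillmoreConservation.pd_comm hf.isOpen hf.smooth hx i j

lemma contDiffOn_metricInv (i j : Fin 2) : ContDiffOn ℝ ∞ (fun y => metricInv f y i j) U :=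
  fun _ hx => (contDiffAt_gram_inv (fun k => hf.contDiffAt (hf.contDiffOn_pd k) hx)
    (hf.det_ne_zero hx) i j).contDiffWithinAt

lemma contDiffOn_areaDensity : ContDiffOn ℝ ∞ (areaDensity f) U :=
  fun _ hx => (contDiffAt_sqrt_det_gram (fun k => hf.contDiffAt (hf.contDiffOn_pd k) hx)
    (hf.det_ne_zero hx)).contDiffWithinAt

lemma areaDensity_pos (hx : x ∈ U) : 0 < areaDensity f x :=
  Real.sqrt_pos.2 ((Matrix.posSemidef_gram ℝ _).det_nonneg.lt_of_ne' (hf.det_ne_zero hx))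

lemma contDiffOn_normalProj {v : Plane → Amb m} (hv : ContDiffOn ℝ ∞ v U) :
    ContDiffOn ℝ ∞ (fun y => normalProj f y (v y)) U :=
  ContDiffOn.congr (fun _ hx => (contDiffAt_normalPart
    (fun k => hf.contDiffAt (hf.contDiffOn_pd k) hx) (hf.det_ne_zero hx)
    (hf.contDiffAt hv hx)).contDiffWithinAt)
    fun _ hy => normalProj_eq_normalPart (hf.det_ne_zero hy) _

lemma sum_metricInv_mul_inner_pd (hx : x ∈ U) (i j : Fin 2) :
    ∑ k, metricInv f x i k * inner ℝ (pd k f x) (pd j f x) = if i = j then 1 else 0 :=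
  sum_gram_inv_mul_inner (hf.det_ne_zero hx) i j

lemma normalProj_eq_sub (hx : x ∈ U) (v : Amb m) :
    normalProj f x v = v - ∑ k, ∑ l, (metricInv f x k l * inner ℝ (pd k f x) v) • pd l f x :=
  normalProj_eq_normalPart (hf.det_ne_zero hx) v

lemma eq_zero_of_normalProj_of_inner_pd (hx : x ∈ U) {v : Amb m} (hN : normalProj f x v = 0)
    (hT : ∀ l, inner ℝ (pd l f x) v = 0) : v = 0 := by
  simpa [hN, hT] using (hf.normalProj_eq_sub hx v).symm

lemma pd_pd_eq_add_normalProj (hx : x ∈ U) (i j : Fin 2) :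
    pd i (pd j f) x = ∑ k, christoffel f k i j x • pd k f x
      + normalProj f x (pd i (pd j f) x) := by
  rw [hf.normalProj_eq_sub hx, Finset.sum_comm]
  simp only [christoffel, Finset.sum_smul, metricInv_symm f x _, real_inner_comm (pd i (pd j f) x)]
  abel

lemma secondForm_coordVec (hx : x ∈ U) (i j : Fin 2) :
    secondForm f x (coordVec i) (coordVec j) = normalProj f x (pd i (pd j f) x) := by
  rw [secondForm, pd_pd_eq hf.isOpen hf.smooth hx]

lemma meanCurv_eq (hx : x ∈ U) : meanCurv f x =
    (1 / 2 : ℝ) • ∑ i, ∑ j, metricInv f x i j • normalProj f x (pd i (pd j f) x) := by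
  simp only [meanCurv, hf.secondForm_coordVec hx]

lemma meanCurv_eq_jetMeanCurv (hx : x ∈ U) :
    meanCurv f x = jetMeanCurv (fun i => pd i f x) fun i j => pd i (pd j f) x := by
  simp only [hf.meanCurv_eq hx, normalProj_eq_normalPart (hf.det_ne_zero hx)]
  rfl

lemma contDiffOn_meanCurv : ContDiffOn ℝ ∞ (meanCurv f) U :=
  ContDiffOn.congr (fun _ hx => (contDiffAt_jetMeanCurv
    (fun k => hf.contDiffAt (hf.contDiffOn_pd k) hx)
    (fun i j => hf.contDiffAt (hf.contDiffOn_pd_pd i j) hx)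
    (hf.det_ne_zero hx)).contDiffWithinAt) fun _ hy => hf.meanCurv_eq_jetMeanCurv hy

lemma christoffel_symm (hx : x ∈ U) (k i j : Fin 2) :
    christoffel f k i j x = christoffel f k j i x := by
  simp only [christoffel, hf.pd_comm hx i j]

lemma hasDerivAt_pd_add_smul_coordVec (hx : x ∈ U) (l k : Fin 2) :
    HasDerivAt (fun t : ℝ => pd k f (x + t • coordVec l)) (pd l (pd k f) x) 0 :=
  hasDerivAt_comp_add_smul_coordVec (hf.differentiableAt (hf.contDiffOn_pd k) hx) l

lemma pd_metricInv (hx : x ∈ U) (l i j : Fin 2) :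
    pd l (fun y => metricInv f y i j) x =
      -(∑ p, christoffel f i l p x * metricInv f x p j
        + ∑ p, metricInv f x i p * christoffel f j l p x) := by
  have hline := hasDerivAt_comp_add_smul_coordVec
    (hf.differentiableAt (hf.contDiffOn_metricInv i j) hx) l
  have hgram := hasDerivAt_gram_inv (a := fun k (t : ℝ) => pd k f (x + t • coordVec l))
    (hf.hasDerivAt_pd_add_smul_coordVec hx l)
    (by simpa only [zero_smul, add_zero] using! hf.det_ne_zero hx) i j
  rw [hline.unique hgram]
  simp only [zero_smul, add_zero, mul_add, add_mul, Finset.sum_add_distrib]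
  congr 2
  · refine Finset.sum_congr rfl fun q _ => ?_
    rw [christoffel, Finset.sum_mul]
    exact Finset.sum_congr rfl fun p _ => by rw [real_inner_comm]; rfl
  · rw [Finset.sum_comm]
    refine Finset.sum_congr rfl fun p _ => ?_
    rw [christoffel, Finset.mul_sum]
    refine Finset.sum_congr rfl fun q _ => ?_
    rw [metricInv_symm f x j q, mul_right_comm, mul_assoc]
    rfl

lemma pd_areaDensity (hx : x ∈ U) (l : Fin 2) :
    pd l (areaDensity f) x = areaDensity f x * ∑ p, christoffel f p l p x := by
  have hline := hasDerivAt_comp_add_smul_coordVec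
    (hf.differentiableAt hf.contDiffOn_areaDensity hx) l
  have hgram := hasDerivAt_sqrt_det_gram (a := fun k (t : ℝ) => pd k f (x + t • coordVec l))
    (hf.hasDerivAt_pd_add_smul_coordVec hx l)
    (by simpa only [zero_smul, add_zero] using! hf.det_ne_zero hx)
  rw [hline.unique hgram]
  simp only [zero_smul, add_zero]
  rw [Finset.sum_comm]
  congr 1
  refine Finset.sum_congr rfl fun p _ => Finset.sum_congr rfl fun r _ => ?_
  rw [metricInv_symm, real_inner_comm]
  rfl

end IsPatch

end Patch

section Codifferential

variable {m : ℕ} {f : Plane → Amb m} {U : Set Plane} {x : Plane}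

/-- The components `√(det g) ∑ g^{ij} α_i` of the vector density dual to the one-form `α`. They are
those of `*_g α` up to order and sign, so that their flat divergence gives `d^{*_g} α`. -/
def sharpDensity (f : Plane → Amb m) (α : Fin 2 → Plane → Amb m) (j : Fin 2) (x : Plane) : Amb m :=
  ∑ i, (areaDensity f x * metricInv f x i j) • α i x

lemma codiff_eq_sum_pd_sharpDensity (f : Plane → Amb m) (α : Fin 2 → Plane → Amb m) (x : Plane) :
    codiff f α x = -((areaDensity f x)⁻¹ • ∑ j, pd j (sharpDensity f α j) x) := by
  unfold sharpDensity
  simp only [codiff, starTwo, extD, starOne, Matrix.cons_val_zero, Matrix.cons_val_one,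
    Matrix.cons_val_fin_one, pd_neg, sub_neg_eq_add, Fin.sum_univ_two, smul_add, smul_smul]

namespace IsPatch

variable (hf : IsPatch f U)
include hf

lemma sum_pd_areaDensity_mul_metricInv (hx : x ∈ U) (i : Fin 2) :
    ∑ j, pd j (fun y => areaDensity f y * metricInv f y i j) x =
      -(areaDensity f x * ∑ j, ∑ k, metricInv f x j k * christoffel f i j k x) := by
  have hprod (j : Fin 2) : pd j (fun y => areaDensity f y * metricInv f y i j) x =
      pd j (areaDensity f) x * metricInv f x i j
        + areaDensity f x * pd j (fun y => metricInv f y i j) x :=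
    pd_mul (hf.differentiableAt hf.contDiffOn_areaDensity hx)
      (hf.differentiableAt (hf.contDiffOn_metricInv i j) hx)
  simp only [hprod, hf.pd_areaDensity hx, hf.pd_metricInv hx, Fin.sum_univ_two,
    metricInv_symm f x 1 0, hf.christoffel_symm hx _ 1 0]
  ring

lemma codiff_eq (hx : x ∈ U) {α : Fin 2 → Plane → Amb m} (hα : ∀ i, DifferentiableAt ℝ (α i) x) :
    codiff f α x = -∑ i, ∑ j,
      metricInv f x i j • (pd j (α i) x - ∑ k, christoffel f k i j x • α k x) := by
  have hcoeff (i j : Fin 2) :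
      DifferentiableAt ℝ (fun y => areaDensity f y * metricInv f y i j) x :=
    (hf.differentiableAt hf.contDiffOn_areaDensity hx).mul
      (hf.differentiableAt (hf.contDiffOn_metricInv i j) hx)
  have hprod (j : Fin 2) :
      pd j (sharpDensity f α j) x =
        ∑ i, (pd j (fun y => areaDensity f y * metricInv f y i j) x • α i x
          + (areaDensity f x * metricInv f x i j) • pd j (α i) x) := by
    unfold sharpDensity
    rw [pd_sum fun i _ => (hcoeff i j).fun_smul (hα i)]
    exact Finset.sum_congr rfl fun i _ => pd_smul (hcoeff i j) (hα i)
  have hρ := (hf.areaDensity_pos hx).ne'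
  rw [codiff_eq_sum_pd_sharpDensity]
  simp only [hprod]
  rw [Finset.sum_comm]
  simp only [Finset.sum_add_distrib, ← Finset.sum_smul, hf.sum_pd_areaDensity_mul_metricInv hx,
    Fin.sum_univ_two]
  match_scalars <;> field_simp <;> ring

end IsPatch

end Codifferential

section MeanCurvature

variable {m : ℕ} {f : Plane → Amb m} {U : Set Plane} {x : Plane}

/-- The component `h_{ij} = ⟨H, 𝕀(∂_i, ∂_j)⟩` of the second fundamental form along the mean
curvature vector; the projection to the normal space is omitted because `H` is normal. -/
def meanSecondForm (f : Plane → Amb m) (i j : Fin 2) (x : Plane) : ℝ :=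
  inner ℝ (meanCurv f x) (pd i (pd j f) x)

/-- The tangent vector `∑ g^{kl} h_{ik} ∂_l f`, the image of `∂_i f` under the shape operator of the
normal field `H`. -/
def shapeForm (f : Plane → Amb m) (i : Fin 2) (x : Plane) : Amb m :=
  ∑ k, ∑ l, (metricInv f x k l * meanSecondForm f i k x) • pd l f x

/-- The one-form `|H|² ∂_i f - ∑ g^{kl} h_{ik} ∂_l f`: minus the trace-free part of the shape
operator of `H`. -/
def traceFreeForm (f : Plane → Amb m) (i : Fin 2) (x : Plane) : Amb m :=
  ‖meanCurv f x‖ ^ 2 • pd i f x - shapeForm f i x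

lemma normalProj_shapeForm (i : Fin 2) : normalProj f x (shapeForm f i x) = 0 := by
  simp only [shapeForm, map_sum, map_smul, normalProj_pd, smul_zero, Finset.sum_const_zero]

lemma normalProj_traceFreeForm (i : Fin 2) : normalProj f x (traceFreeForm f i x) = 0 := by
  rw [traceFreeForm, map_sub, map_smul, normalProj_pd, normalProj_shapeForm, smul_zero, sub_zero]

namespace IsPatch

variable (hf : IsPatch f U)
include hf

lemma meanSecondForm_symm (hx : x ∈ U) (i j : Fin 2) :
    meanSecondForm f i j x = meanSecondForm f j i x := by
  rw [meanSecondForm, hf.pd_comm hx, meanSecondForm]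

lemma inner_pd_shapeForm (hx : x ∈ U) (i j : Fin 2) :
    inner ℝ (pd j f x) (shapeForm f i x) = meanSecondForm f i j x := by
  simp only [shapeForm, inner_sum, real_inner_smul_right]
  calc ∑ k, ∑ l, metricInv f x k l * meanSecondForm f i k x * inner ℝ (pd j f x) (pd l f x)
      = ∑ k, meanSecondForm f i k x *
          ∑ l, metricInv f x k l * inner ℝ (pd l f x) (pd j f x) := by
        simp only [Finset.mul_sum, real_inner_comm (pd j f x)]
        exact Finset.sum_congr rfl fun k _ => Finset.sum_congr rfl fun l _ => by ring
    _ = meanSecondForm f i j x := by simp [hf.sum_metricInv_mul_inner_pd hx]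

lemma sum_metricInv_mul_inner_normalProj (hx : x ∈ U) (v : Amb m) :
    ∑ i, ∑ j, metricInv f x i j * inner ℝ (normalProj f x v) (pd i (pd j f) x) =
      2 * inner ℝ v (meanCurv f x) := by
  simp only [hf.meanCurv_eq hx, real_inner_smul_right, inner_sum, inner_normalProj_left]
  ring

lemma sum_metricInv_mul_meanSecondForm (hx : x ∈ U) :
    ∑ i, ∑ j, metricInv f x i j * meanSecondForm f i j x = 2 * ‖meanCurv f x‖ ^ 2 := by
  simpa only [normalProj_meanCurv, real_inner_self_eq_norm_sq] using!
    hf.sum_metricInv_mul_inner_normalProj hx (meanCurv f x)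

lemma pd_norm_sq_meanCurv (hx : x ∈ U) (i : Fin 2) :
    pd i (fun y => ‖meanCurv f y‖ ^ 2) x = 2 * inner ℝ (pd i (meanCurv f) x) (meanCurv f x) := by
  have hH := hf.differentiableAt hf.contDiffOn_meanCurv hx
  simp only [← real_inner_self_eq_norm_sq]
  rw [pd_inner hH hH, real_inner_comm (pd i (meanCurv f) x), two_mul]

lemma inner_pd_pd_meanCurv (hx : x ∈ U) (i k : Fin 2) :
    inner ℝ (pd k f x) (pd i (meanCurv f) x) = -meanSecondForm f i k x := by
  have h := pd_inner (i := i) (hf.differentiableAt hf.contDiffOn_meanCurv hx)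
    (hf.differentiableAt (hf.contDiffOn_pd k) hx)
  simp only [inner_meanCurv_pd, pd_const] at h
  rw [real_inner_comm, meanSecondForm]
  linarith

lemma normalD_meanCurv (hx : x ∈ U) (i : Fin 2) :
    normalD f (meanCurv f) i x = pd i (meanCurv f) x + shapeForm f i x := by
  rw [normalD, hf.normalProj_eq_sub hx]
  simp only [hf.inner_pd_pd_meanCurv hx, mul_neg, neg_smul, Finset.sum_neg_distrib,
    sub_neg_eq_add, shapeForm]

end IsPatch

end MeanCurvature

section GaussMap

variable {m : ℕ} {f : Plane → Amb m} {U : Set Plane} {x : Plane}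

lemma pdMulti_bilinear (B : Amb m →ₗ[ℝ] Amb m →ₗ[ℝ] Multivec m) {u v : Plane → Amb m}
    (hu : DifferentiableAt ℝ u x) (hv : DifferentiableAt ℝ v x) (i : Fin 2) :
    pdMulti i (fun y => B (u y) (v y)) x = B (pd i u x) (v x) + B (u x) (pd i v x) := by
  have hcoord (S : Finset (Fin m)) : pd i (fun y => (multiBasis m).repr (B (u y) (v y)) S) x =
      (multiBasis m).repr (B (pd i u x) (v x) + B (u x) (pd i v x)) S := by
    let C : Amb m →L[ℝ] Amb m →L[ℝ] ℝ :=
      (B.compr₂ ((multiBasis m).coord S)).toContinuousBilinearMap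
    have hC := (C.hasFDerivAt_of_bilinear hu.hasFDerivAt hv.hasFDerivAt).fderiv
    change fderiv ℝ (fun y => C (u y) (v y)) x (coordVec i) = _
    rw [hC, map_add, Finsupp.add_apply, add_comm ((multiBasis m).repr _ S)]
    rfl
  simp only [pdMulti, hcoord]
  exact (multiBasis m).sum_repr _

lemma map_starOne {V W : Type*} [AddCommGroup V] [Module ℝ V] [AddCommGroup W] [Module ℝ W]
    (L : V →ₗ[ℝ] W) (f : Plane → Amb m) (α : Fin 2 → Plane → V) (i : Fin 2) (x : Plane) :
    L (starOne f α i x) = starOne f (fun j y => L (α j y)) i x := by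
  fin_cases i <;> simp [starOne]

namespace IsPatch

variable (hf : IsPatch f U)
include hf

lemma toVec_hodge_pdMulti_gaussMap_mul (hx : x ∈ U) (i : Fin 2) :
    toVec (hodge m (pdMulti i (gaussMap f) x * toMulti (meanCurv f x))) =
      (areaDensity f x)⁻¹ • (meanSecondForm f i 0 x • pd 1 f x
        - meanSecondForm f i 1 x • pd 0 f x) := by
  let B : Amb m →ₗ[ℝ] Amb m →ₗ[ℝ] Multivec m :=
    ((LinearMap.mul ℝ (Multivec m)).compl₁₂ (ExteriorAlgebra.ι ℝ) (ExteriorAlgebra.ι ℝ)).compr₂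
      (hodge m)
  have hB (u v : Amb m) : B u v = hodge m (toMulti u * toMulti v) := rfl
  have hρ : DifferentiableAt ℝ (fun y => (areaDensity f y)⁻¹) x :=
    (hf.differentiableAt hf.contDiffOn_areaDensity hx).inv (hf.areaDensity_pos hx).ne'
  have hd (k : Fin 2) := hf.differentiableAt (hf.contDiffOn_pd k) hx
  have hgauss : gaussMap f = fun y => B ((areaDensity f y)⁻¹ • pd 0 f y) (pd 1 f y) := by
    ext y; simp [gaussMap, hB, toMulti]
  have htoVec (a b : Multivec m) : toVec (a + b) = toVec a + toVec b := map_add _ a b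
  rw [hgauss, pdMulti_bilinear B (hρ.fun_smul (hd 0)) (hd 1), hB, hB, add_mul, map_add, htoVec,
    toVec_hodge_hodge_mul, toVec_hodge_hodge_mul, pd_smul hρ (hd 0)]
  simp only [real_inner_comm (meanCurv f x), inner_add_right, real_inner_smul_right,
    inner_meanCurv_pd, mul_zero, zero_smul, zero_add, zero_sub, sub_zero, meanSecondForm]
  module

lemma toVec_hodge_starOne_gaussMap_mul (hx : x ∈ U) (i : Fin 2) :
    toVec (hodge m (starOne f (fun j => pdMulti j (gaussMap f)) i x * toMulti (meanCurv f x))) =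
      (2 * ‖meanCurv f x‖ ^ 2) • pd i f x - shapeForm f i x := by
  let L : Multivec m →ₗ[ℝ] Amb m :=
    ExteriorAlgebra.ιInv ∘ₗ hodge m ∘ₗ LinearMap.mulRight ℝ (toMulti (meanCurv f x))
  have hL (j : Fin 2) : L (pdMulti j (gaussMap f) x) = _ :=
    hf.toVec_hodge_pdMulti_gaussMap_mul hx j
  have hρ := (hf.areaDensity_pos hx).ne'
  refine (map_starOne L f _ i x).trans ?_
  rw [← hf.sum_metricInv_mul_meanSecondForm hx, shapeForm]
  fin_cases i <;>
    simp only [starOne, hL, Fin.sum_univ_two, Fin.zero_eta, Fin.mk_one, Matrix.cons_val_zero,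
      Matrix.cons_val_one, Matrix.cons_val_fin_one, metricInv_symm f x 1 0,
      hf.meanSecondForm_symm hx 1 0] <;>
    match_scalars <;> field_simp <;> ring

lemma conservedForm_eq (hx : x ∈ U) (i : Fin 2) :
    conservedForm f i x =
      (-2 : ℝ) • normalD f (meanCurv f) i x + (2 : ℝ) • traceFreeForm f i x := by
  rw [conservedForm, hf.toVec_hodge_starOne_gaussMap_mul hx, traceFreeForm,
    eq_sub_of_add_eq (hf.normalD_meanCurv hx i).symm]
  module

end IsPatch

end GaussMap

/-! ### The divergence form of the Willmore operator -/

section Codazzi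

variable {m : ℕ} {f : Plane → Amb m} {U : Set Plane} {x : Plane}

/-- The covariant derivative `∇_j h_{il}` of the form `h_{il} = ⟨H, 𝕀(∂_i, ∂_l)⟩`. -/
def covMeanSecondForm (f : Plane → Amb m) (j i l : Fin 2) (x : Plane) : ℝ :=
  pd j (meanSecondForm f i l) x - ∑ k, christoffel f k j i x * meanSecondForm f k l x
    - ∑ k, christoffel f k j l x * meanSecondForm f i k x

lemma inner_shapeForm_pd_pd (i j l : Fin 2) :
    inner ℝ (shapeForm f i x) (pd j (pd l f) x) =
      ∑ k, christoffel f k j l x * meanSecondForm f i k x := by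
  simp only [shapeForm, sum_inner, real_inner_smul_left, christoffel, Finset.sum_mul]
  exact Finset.sum_congr rfl fun k _ => Finset.sum_congr rfl fun p _ => by
    rw [real_inner_comm]; ring

namespace IsPatch

variable (hf : IsPatch f U)
include hf

lemma differentiableAt_meanSecondForm (hx : x ∈ U) (i j : Fin 2) :
    DifferentiableAt ℝ (meanSecondForm f i j) x :=
  (hf.differentiableAt hf.contDiffOn_meanCurv hx).inner ℝ
    (hf.differentiableAt (hf.contDiffOn_pd_pd i j) hx)

lemma pd_meanSecondForm (hx : x ∈ U) (j i l : Fin 2) :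
    pd j (meanSecondForm f i l) x = inner ℝ (normalD f (meanCurv f) j x) (pd i (pd l f) x)
      - ∑ k, christoffel f k i l x * meanSecondForm f j k x
      + inner ℝ (meanCurv f x) (pd j (pd i (pd l f)) x) := by
  rw [← inner_shapeForm_pd_pd, ← inner_sub_left, hf.normalD_meanCurv hx, add_sub_cancel_right]
  exact pd_inner (hf.differentiableAt hf.contDiffOn_meanCurv hx)
    (hf.differentiableAt (hf.contDiffOn_pd_pd i l) hx)

lemma codazzi (hx : x ∈ U) (j i l : Fin 2) :
    covMeanSecondForm f j i l x - inner ℝ (normalD f (meanCurv f) j x) (pd i (pd l f) x) =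
      covMeanSecondForm f l i j x - inner ℝ (normalD f (meanCurv f) l x) (pd i (pd j f) x) := by
  have hthird : pd j (pd i (pd l f)) x = pd l (pd i (pd j f)) x := by
    rw [WillmoreConservation.pd_comm hf.isOpen (hf.contDiffOn_pd l) hx,
      pd_congr hf.isOpen hx (fun y hy => hf.pd_comm hy j l),
      WillmoreConservation.pd_comm hf.isOpen (hf.contDiffOn_pd j) hx]
  simp only [covMeanSecondForm, hf.pd_meanSecondForm hx, hthird, hf.christoffel_symm hx _ j,
    hf.meanSecondForm_symm hx j]
  simp only [hf.christoffel_symm hx _ l, hf.meanSecondForm_symm hx l]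
  ring

lemma sum_metricInv_mul_covMeanSecondForm (hx : x ∈ U) (l : Fin 2) :
    ∑ i, ∑ j, metricInv f x i j * covMeanSecondForm f l i j x =
      2 * pd l (fun y => ‖meanCurv f y‖ ^ 2) x := by
  have hterm (i j : Fin 2) : pd l (fun y => metricInv f y i j * meanSecondForm f i j y) x =
      pd l (fun y => metricInv f y i j) x * meanSecondForm f i j x
        + metricInv f x i j * pd l (meanSecondForm f i j) x :=
    pd_mul (hf.differentiableAt (hf.contDiffOn_metricInv i j) hx)
      (hf.differentiableAt_meanSecondForm hx i j)
  have hd (i j : Fin 2) := (hf.differentiableAt (hf.contDiffOn_metricInv i j) hx).fun_mul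
    (hf.differentiableAt_meanSecondForm hx i j)
  have hsum : pd l (fun y => ∑ i, ∑ j, metricInv f y i j * meanSecondForm f i j y) x =
      ∑ i, ∑ j, (pd l (fun y => metricInv f y i j) x * meanSecondForm f i j x
        + metricInv f x i j * pd l (meanSecondForm f i j) x) := by
    rw [pd_sum fun i _ => .fun_sum fun j _ => hd i j]
    exact Finset.sum_congr rfl fun i _ => (pd_sum fun j _ => hd i j).trans
      (Finset.sum_congr rfl fun j _ => hterm i j)
  have hH := hf.differentiableAt (hf.contDiffOn_meanCurv.norm_sq ℝ) hx
  have htrace := pd_congr (i := l) hf.isOpen hx fun y hy => hf.sum_metricInv_mul_meanSecondForm hy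
  rw [hsum, pd_mul (differentiableAt_const _) hH, pd_const] at htrace
  simp only [hf.pd_metricInv hx, Fin.sum_univ_two, metricInv_symm f x 1 0,
    hf.meanSecondForm_symm hx 1 0] at htrace
  simp only [covMeanSecondForm, Fin.sum_univ_two, metricInv_symm f x 1 0,
    hf.meanSecondForm_symm hx 1 0]
  linear_combination htrace

lemma sum_metricInv_mul_covMeanSecondForm_left (hx : x ∈ U) (l : Fin 2) :
    ∑ i, ∑ j, metricInv f x i j * covMeanSecondForm f j i l x =
      pd l (fun y => ‖meanCurv f y‖ ^ 2) x
        + ∑ i, ∑ j, metricInv f x i j *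
          inner ℝ (normalD f (meanCurv f) j x) (pd i (pd l f) x) := by
  have htrace := hf.sum_metricInv_mul_inner_normalProj hx (pd l (meanCurv f) x)
  rw [← hf.pd_norm_sq_meanCurv hx] at htrace
  change ∑ i, ∑ j, metricInv f x i j * inner ℝ (normalD f (meanCurv f) l x) _ = _ at htrace
  have hcod (i j : Fin 2) := sub_eq_iff_eq_add.1 (hf.codazzi hx j i l)
  simp only [hcod, mul_add, mul_sub, Finset.sum_add_distrib, Finset.sum_sub_distrib,
    hf.sum_metricInv_mul_covMeanSecondForm hx, htrace]
  ring

end IsPatch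

end Codazzi

section TangentialPart

variable {m : ℕ} {f : Plane → Amb m} {U : Set Plane} {x : Plane}

namespace IsPatch

variable (hf : IsPatch f U)
include hf

lemma contDiffOn_normalD (i : Fin 2) : ContDiffOn ℝ ∞ (normalD f (meanCurv f) i) U :=
  hf.contDiffOn_normalProj
    (WillmoreConservation.contDiffOn_pd hf.isOpen hf.contDiffOn_meanCurv i)

lemma contDiffOn_traceFreeForm (i : Fin 2) : ContDiffOn ℝ ∞ (traceFreeForm f i) U :=
  ((hf.contDiffOn_meanCurv.norm_sq ℝ).smul (hf.contDiffOn_pd i)).sub <|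
    ContDiffOn.sum fun k _ => ContDiffOn.sum fun l _ => ((hf.contDiffOn_metricInv k l).mul
      (hf.contDiffOn_meanCurv.inner ℝ (hf.contDiffOn_pd_pd i k))).smul (hf.contDiffOn_pd l)

lemma inner_pd_pd_of_normalProj_eq_zero (hx : x ∈ U) (j l : Fin 2) {v : Amb m}
    (hv : normalProj f x v = 0) :
    inner ℝ (pd j (pd l f) x) v = ∑ k, christoffel f k j l x * inner ℝ (pd k f x) v := by
  rw [hf.pd_pd_eq_add_normalProj hx j l, inner_add_left, inner_normalProj_left, hv,
    inner_zero_right, add_zero, sum_inner]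
  simp only [real_inner_smul_left]

lemma inner_codiff (hx : x ∈ U) {α : Fin 2 → Plane → Amb m}
    (hα : ∀ i, DifferentiableAt ℝ (α i) x) (v : Amb m) :
    inner ℝ v (codiff f α x) = -∑ i, ∑ j, metricInv f x i j *
      (inner ℝ v (pd j (α i) x) - ∑ k, christoffel f k i j x * inner ℝ v (α k x)) := by
  simp only [hf.codiff_eq hx hα, inner_neg_right, inner_sum, real_inner_smul_right,
    inner_sub_right]

lemma inner_pd_traceFreeForm (hx : x ∈ U) (i l : Fin 2) :
    inner ℝ (pd l f x) (traceFreeForm f i x) =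
      ‖meanCurv f x‖ ^ 2 * inner ℝ (pd l f x) (pd i f x) - meanSecondForm f i l x := by
  rw [traceFreeForm, inner_sub_right, real_inner_smul_right, hf.inner_pd_shapeForm hx]

lemma inner_pd_pd_traceFreeForm (hx : x ∈ U) (i j l : Fin 2) :
    inner ℝ (pd l f x) (pd j (traceFreeForm f i) x)
        - ∑ k, christoffel f k i j x * inner ℝ (pd l f x) (traceFreeForm f k x) =
      pd j (fun y => ‖meanCurv f y‖ ^ 2) x * inner ℝ (pd i f x) (pd l f x)
        - covMeanSecondForm f j i l x := by
  have hd (k : Fin 2) := hf.differentiableAt (hf.contDiffOn_pd k) hx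
  have hH := hf.differentiableAt (hf.contDiffOn_meanCurv.norm_sq ℝ) hx
  have hleft : pd j (fun y => inner ℝ (pd l f y) (traceFreeForm f i y)) x = _ :=
    pd_inner (hd l) (hf.differentiableAt (hf.contDiffOn_traceFreeForm i) hx)
  have hright : pd j (fun y => ‖meanCurv f y‖ ^ 2 * inner ℝ (pd l f y) (pd i f y)
      - meanSecondForm f i l y) x = _ :=
    pd_sub (hH.fun_mul ((hd l).inner ℝ (hd i))) (hf.differentiableAt_meanSecondForm hx i l)
  rw [pd_mul hH ((hd l).inner ℝ (hd i)), pd_inner (hd l) (hd i)] at hright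
  have hprod := pd_congr (i := j) hf.isOpen hx fun y hy => hf.inner_pd_traceFreeForm hy i l
  rw [hleft, hright, hf.inner_pd_pd_of_normalProj_eq_zero hx j l (normalProj_traceFreeForm i),
    hf.inner_pd_pd_of_normalProj_eq_zero hx j l (normalProj_pd i),
    real_inner_comm (pd j (pd i f) x),
    hf.inner_pd_pd_of_normalProj_eq_zero hx j i (normalProj_pd l)] at hprod
  simp only [covMeanSecondForm, hf.inner_pd_traceFreeForm hx, Fin.sum_univ_two,
    real_inner_comm (pd l f x), hf.christoffel_symm hx _ i j] at hprod ⊢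
  linear_combination hprod

lemma inner_pd_codiff_traceFreeForm (hx : x ∈ U) (l : Fin 2) :
    inner ℝ (pd l f x) (codiff f (traceFreeForm f) x) = ∑ i, ∑ j, metricInv f x i j *
      inner ℝ (normalD f (meanCurv f) j x) (pd i (pd l f) x) := by
  have htrace : ∑ i, ∑ j, metricInv f x i j *
      (pd j (fun y => ‖meanCurv f y‖ ^ 2) x * inner ℝ (pd i f x) (pd l f x)) =
      pd l (fun y => ‖meanCurv f y‖ ^ 2) x := by
    have hcol (j : Fin 2) : ∑ i, metricInv f x i j *
        (pd j (fun y => ‖meanCurv f y‖ ^ 2) x * inner ℝ (pd i f x) (pd l f x)) =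
        if j = l then pd j (fun y => ‖meanCurv f y‖ ^ 2) x else 0 := by
      rw [← mul_boole, ← hf.sum_metricInv_mul_inner_pd hx, Finset.mul_sum]
      exact Finset.sum_congr rfl fun i _ => by rw [metricInv_symm]; ring
    rw [Finset.sum_comm]
    simp only [hcol, Finset.sum_ite_eq', Finset.mem_univ, if_true]
  rw [hf.inner_codiff hx fun i => hf.differentiableAt (hf.contDiffOn_traceFreeForm i) hx]
  simp only [hf.inner_pd_pd_traceFreeForm hx, mul_sub, Finset.sum_sub_distrib, htrace,
    hf.sum_metricInv_mul_covMeanSecondForm_left hx]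
  ring

lemma inner_pd_codiff_normalD (hx : x ∈ U) (l : Fin 2) :
    inner ℝ (pd l f x) (codiff f (normalD f (meanCurv f)) x) = ∑ i, ∑ j, metricInv f x i j *
      inner ℝ (normalD f (meanCurv f) j x) (pd i (pd l f) x) := by
  have hnormal (i : Fin 2) (y : Plane) :
      inner ℝ (pd l f y) (normalD f (meanCurv f) i y) = 0 := by
    rw [real_inner_comm]; exact inner_normalProj_pd _ l
  have hP (i : Fin 2) := hf.differentiableAt (hf.contDiffOn_normalD i) hx
  have hpd (i j : Fin 2) : inner ℝ (pd l f x) (pd j (normalD f (meanCurv f) i) x) =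
      -inner ℝ (normalD f (meanCurv f) i x) (pd j (pd l f) x) := by
    have h := pd_inner (i := j) (hf.differentiableAt (hf.contDiffOn_pd l) hx) (hP i)
    simp only [hnormal, pd_const] at h
    rw [real_inner_comm (pd j (pd l f) x)]
    linarith
  rw [hf.inner_codiff hx hP, Finset.sum_comm]
  simp only [hnormal, hpd, mul_zero, Finset.sum_const_zero, sub_zero, mul_neg,
    Finset.sum_neg_distrib, neg_neg, metricInv_symm f x]

end IsPatch

end TangentialPart

section NormalPart

variable {m : ℕ} {f : Plane → Amb m} {U : Set Plane} {x : Plane}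

lemma metricInv_eq_sum_of_orthonormal {e : Fin 2 → Plane}
    (he : Orthonormal ℝ fun i => fderiv ℝ f x (e i)) (k l : Fin 2) :
    metricInv f x k l = ∑ p, e p k * e p l := by
  let A : Matrix (Fin 2) (Fin 2) ℝ := Matrix.of fun i k => e i k
  have hgram : A * (metric f x * A.transpose) = 1 := by
    ext i j
    rw [Matrix.one_apply, ← orthonormal_iff_ite.1 he i j, fderiv_apply_eq, fderiv_apply_eq]
    simp only [Matrix.mul_apply, A, Matrix.of_apply, Matrix.transpose_apply, metric, sum_inner,
      inner_sum, real_inner_smul_left, real_inner_smul_right, Finset.mul_sum]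
    rw [Finset.sum_comm]
    exact Finset.sum_congr rfl fun p _ => Finset.sum_congr rfl fun q _ => by ring
  rw [mul_eq_one_comm, Matrix.mul_assoc] at hgram
  rw [metricInv, Matrix.inv_eq_right_inv hgram]
  simp [Matrix.mul_apply, A]

namespace IsPatch

variable (hf : IsPatch f U)
include hf

lemma normalProj_pd_of_normalProj_eq_zero (hx : x ∈ U) {v : Plane → Amb m}
    (hv : ContDiffOn ℝ ∞ v U) (hN : ∀ y ∈ U, normalProj f y (v y) = 0) (j : Fin 2) :
    normalProj f x (pd j v x) = ∑ k, ∑ l,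
      (metricInv f x k l * inner ℝ (pd k f x) (v x)) • normalProj f x (pd j (pd l f) x) := by
  have hcoeff (k l : Fin 2) :
      DifferentiableAt ℝ (fun y => metricInv f y k l * inner ℝ (pd k f y) (v y)) x :=
    hf.differentiableAt
      ((hf.contDiffOn_metricInv k l).mul ((hf.contDiffOn_pd k).inner ℝ hv)) hx
  have hframe (l : Fin 2) := hf.differentiableAt (hf.contDiffOn_pd l) hx
  have hexpand : Set.EqOn v
      (fun y => ∑ k, ∑ l, (metricInv f y k l * inner ℝ (pd k f y) (v y)) • pd l f y) U :=
    fun y hy => sub_eq_zero.1 ((hf.normalProj_eq_sub hy (v y)).symm.trans (hN y hy))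
  rw [pd_congr hf.isOpen hx hexpand,
    pd_sum fun k _ => .fun_sum fun l _ => (hcoeff k l).fun_smul (hframe l), map_sum]
  refine Finset.sum_congr rfl fun k _ => ?_
  rw [pd_sum fun l _ => (hcoeff k l).fun_smul (hframe l), map_sum]
  refine Finset.sum_congr rfl fun l _ => ?_
  rw [pd_smul (hcoeff k l) (hframe l), map_add, map_smul, map_smul, normalProj_pd, smul_zero,
    zero_add]

lemma normalProj_pd_traceFreeForm (hx : x ∈ U) (i j : Fin 2) :
    normalProj f x (pd j (traceFreeForm f i) x) =
      ‖meanCurv f x‖ ^ 2 • normalProj f x (pd i (pd j f) x)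
        - ∑ k, ∑ l, (metricInv f x k l * meanSecondForm f i k x) •
          normalProj f x (pd j (pd l f) x) := by
  have hmetric : ∑ k, ∑ l, (metricInv f x k l * inner ℝ (pd k f x) (pd i f x)) •
      normalProj f x (pd j (pd l f) x) = normalProj f x (pd i (pd j f) x) := by
    rw [Finset.sum_comm]
    simp only [← Finset.sum_smul, metricInv_symm f x _, hf.sum_metricInv_mul_inner_pd hx,
      ite_smul, one_smul, zero_smul, Finset.sum_ite_eq', Finset.mem_univ, if_true, hf.pd_comm hx i]
  rw [hf.normalProj_pd_of_normalProj_eq_zero hx (hf.contDiffOn_traceFreeForm i)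
    fun y _ => normalProj_traceFreeForm i, ← hmetric]
  simp only [hf.inner_pd_traceFreeForm hx, Finset.smul_sum, ← Finset.sum_sub_distrib]
  exact Finset.sum_congr rfl fun k _ => Finset.sum_congr rfl fun l _ => by module

lemma normalProj_codiff_traceFreeForm (hx : x ∈ U) :
    normalProj f x (codiff f (traceFreeForm f) x) =
      ∑ i, ∑ j, ∑ k, ∑ l, (metricInv f x i j * metricInv f x k l * meanSecondForm f i k x) •
        normalProj f x (pd j (pd l f) x) - (2 * ‖meanCurv f x‖ ^ 2) • meanCurv f x := by
  have htrace : ∑ i, ∑ j, metricInv f x i j • normalProj f x (pd i (pd j f) x) =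
      (2 : ℝ) • meanCurv f x := by
    rw [hf.meanCurv_eq hx, smul_smul]
    norm_num
  rw [hf.codiff_eq hx fun i => hf.differentiableAt (hf.contDiffOn_traceFreeForm i) hx]
  simp only [map_neg, map_sum, map_smul, map_sub, hf.normalProj_pd_traceFreeForm hx,
    normalProj_traceFreeForm, smul_zero, Finset.sum_const_zero, sub_zero, smul_sub,
    Finset.sum_sub_distrib, smul_comm _ (‖meanCurv f x‖ ^ 2)]
  simp only [← Finset.smul_sum, htrace]
  simp only [Finset.smul_sum, smul_smul, mul_assoc]
  module

lemma secondForm_eq_sum (hx : x ∈ U) (X Y : Plane) :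
    secondForm f x X Y = ∑ k, ∑ l, (X k * Y l) • normalProj f x (pd k (pd l f) x) := by
  simp only [← hf.secondForm_coordVec hx, secondForm]
  conv_lhs => rw [plane_eq_sum X, plane_eq_sum Y]
  simp only [map_sum, map_smul, sum_apply, smul_apply,
    Finset.smul_sum, smul_smul]
  rw [Finset.sum_comm]
  exact Finset.sum_congr rfl fun k _ => Finset.sum_congr rfl fun l _ => by rw [mul_comm]

lemma tildeA_meanCurv (hx : x ∈ U) {e : Fin 2 → Plane}
    (he : Orthonormal ℝ fun i => fderiv ℝ f x (e i)) :
    tildeA f x e (meanCurv f x) =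
      ∑ i, ∑ j, ∑ k, ∑ l, (metricInv f x i j * metricInv f x k l * meanSecondForm f i k x) •
        normalProj f x (pd j (pd l f) x) := by
  have hframe (k l : Fin 2) : metricInv f x k l = ∑ p, e p k * e p l :=
    metricInv_eq_sum_of_orthonormal he k l
  have hnormal (k l : Fin 2) : inner ℝ (normalProj f x (pd k (pd l f) x)) (meanCurv f x) =
      meanSecondForm f k l x := by
    rw [inner_normalProj_left, normalProj_meanCurv, real_inner_comm, meanSecondForm]
  simp only [tildeA, hf.secondForm_eq_sum hx, sum_inner, real_inner_smul_left, hnormal, hframe]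
  simp only [Fin.sum_univ_two, hf.meanSecondForm_symm hx 1 0, hf.pd_comm hx 1 0]
  module

lemma codiff_conservedForm (hx : x ∈ U) : codiff f (conservedForm f) x =
    (2 : ℝ) • (codiff f (traceFreeForm f) x - codiff f (normalD f (meanCurv f)) x) := by
  have hT (i : Fin 2) := hf.differentiableAt (hf.contDiffOn_traceFreeForm i) hx
  have hP (i : Fin 2) := hf.differentiableAt (hf.contDiffOn_normalD i) hx
  have hC (i : Fin 2) : Set.EqOn (conservedForm f i) (fun y =>
      (-2 : ℝ) • normalD f (meanCurv f) i y + (2 : ℝ) • traceFreeForm f i y) U :=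
    fun y hy => hf.conservedForm_eq hy i
  have hpd (i j : Fin 2) : pd j (conservedForm f i) x =
      (-2 : ℝ) • pd j (normalD f (meanCurv f) i) x + (2 : ℝ) • pd j (traceFreeForm f i) x := by
    rw [pd_congr hf.isOpen hx (hC i), pd_add ((hP i).fun_const_smul _) ((hT i).fun_const_smul _),
      pd_const_smul _ (hP i), pd_const_smul _ (hT i)]
  rw [hf.codiff_eq hx hT, hf.codiff_eq hx hP, hf.codiff_eq hx fun i => ?_]
  · simp only [hpd, hC _ hx, Fin.sum_univ_two]
    module
  · exact (((hP i).fun_const_smul _).fun_add ((hT i).fun_const_smul _)).congr_of_eventuallyEq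
      (Filter.eventuallyEq_of_mem (hf.isOpen.mem_nhds hx) (hC i))

theorem willmore_identity (hx : x ∈ U) {e : Fin 2 → Plane}
    (he : Orthonormal ℝ fun i => fderiv ℝ f x (e i)) :
    normalLaplacian f (meanCurv f) x + tildeA f x e (meanCurv f x)
        - (2 * ‖meanCurv f x‖ ^ 2) • meanCurv f x
      = (1 / 2 : ℝ) • codiff f (conservedForm f) x := by
  set δ := codiff f (traceFreeForm f) x - codiff f (normalD f (meanCurv f)) x with hδ
  have hnormal : normalProj f x δ = δ := by
    refine sub_eq_zero.1 (hf.eq_zero_of_normalProj_of_inner_pd hx ?_ fun l => ?_)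
    · rw [map_sub, normalProj_normalProj, sub_self]
    · rw [inner_sub_right, hδ, inner_sub_right, hf.inner_pd_codiff_traceFreeForm hx,
        hf.inner_pd_codiff_normalD hx, sub_self, sub_zero, real_inner_comm, inner_normalProj_pd]
  rw [hf.codiff_conservedForm hx, ← hδ, smul_smul, ← hnormal, hδ, map_sub,
    hf.normalProj_codiff_traceFreeForm hx, ← hf.tildeA_meanCurv hx he, normalLaplacian]
  module

end IsPatch

end NormalPart

section Charts

lemma isPatch_of_chart {m : ℕ} {M : Type*} [TopologicalSpace M] [ChartedSpace Plane M]
    [IsManifold (𝓡 2) ∞ M] {Φ : M → Amb m} (hΦ : ContMDiff (𝓡 2) 𝓘(ℝ, Amb m) ∞ Φ)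
    (hinj : ∀ p, Function.Injective (mfderiv (𝓡 2) 𝓘(ℝ, Amb m) Φ p))
    {φ : OpenPartialHomeomorph M Plane} (hφ : φ ∈ IsManifold.maximalAtlas (𝓡 2) ∞ M) :
    IsPatch (Φ ∘ φ.symm) φ.target where
  isOpen := φ.open_target
  smooth := contMDiffOn_iff_contDiffOn.1
    (hΦ.comp_contMDiffOn (contMDiffOn_symm_of_mem_maximalAtlas hφ))
  injective x hx := by
    have hdiff : φ.MDifferentiable (𝓡 2) (𝓡 2) :=
      ⟨(contMDiffOn_of_mem_maximalAtlas hφ).mdifferentiableOn (by simp),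
        (contMDiffOn_symm_of_mem_maximalAtlas hφ).mdifferentiableOn (by simp)⟩
    have hchain := mfderiv_comp x ((hΦ (φ.symm x)).mdifferentiableAt (by simp))
      (hdiff.mdifferentiableAt_symm hx)
    rw [mfderiv_eq_fderiv] at hchain
    rw [hchain]
    exact (hinj _).comp (hdiff.symm.mfderiv_injective hx)

end Charts

/-! ### The first variation of the Willmore energy -/

section CompactSupport

variable {W : Type*} [NormedAddCommGroup W] [NormedSpace ℝ W] {K U : Set Plane} {x : Plane}

lemma contDiff_of_eq_zero_of_notMem {u : Plane → W} (hU : IsOpen U) (hu : ContDiffOn ℝ ∞ u U)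
    (hK : IsClosed K) (hKU : K ⊆ U) (h : ∀ x ∉ K, u x = 0) : ContDiff ℝ ∞ u := by
  refine contDiff_iff_contDiffAt.2 fun x => ?_
  by_cases hx : x ∈ U
  · exact hu.contDiffAt (hU.mem_nhds hx)
  · exact contDiffAt_const.congr_of_eventuallyEq (Filter.eventuallyEq_of_mem
      (hK.isOpen_compl.mem_nhds fun hxK => hx (hKU hxK)) h)

lemma pd_eq_zero_of_notMem {u : Plane → W} (hK : IsClosed K) (h : ∀ x ∉ K, u x = 0) (hx : x ∉ K)
    (i : Fin 2) : pd i u x = 0 := by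
  rw [pd_congr (v := fun _ => 0) hK.isOpen_compl hx h, pd_const]

lemma integrable_of_eq_zero_of_notMem {u : Plane → W} (hU : IsOpen U) (hu : ContDiffOn ℝ ∞ u U)
    (hK : IsCompact K) (hKU : K ⊆ U) (h : ∀ x ∉ K, u x = 0) : MeasureTheory.Integrable u :=
  (contDiff_of_eq_zero_of_notMem hU hu hK.isClosed hKU h).continuous.integrable_of_hasCompactSupport
    (HasCompactSupport.intro hK h)

lemma integral_pd_eq_zero {u : Plane → ℝ} (hu : ContDiff ℝ ∞ u) (hs : HasCompactSupport u)
    (i : Fin 2) : ∫ x, pd i u x = 0 := by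
  have hcont : Continuous (fun x => fderiv ℝ u x (coordVec i)) :=
    (hu.continuous_fderiv (by simp)).clm_apply continuous_const
  have hparts := integral_mul_fderiv_eq_neg_fderiv_mul_of_integrable
    (μ := MeasureTheory.volume) (f := fun _ : Plane => (1 : ℝ)) (g := u) (v := coordVec i)
    (by simp) (by simpa using hcont.integrable_of_hasCompactSupport (hs.fderiv_apply ℝ _))
    (by simpa using hu.continuous.integrable_of_hasCompactSupport hs)
    (fun _ _ => differentiableAt_const _) (fun x _ => hu.differentiable (by simp) x)
  simpa [pd] using hparts

lemma integrable_sum_pd {X : Fin 2 → Plane → ℝ} (hU : IsOpen U)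
    (hX : ∀ j, ContDiffOn ℝ ∞ (X j) U) (hK : IsCompact K) (hKU : K ⊆ U)
    (h : ∀ j, ∀ x ∉ K, X j x = 0) : MeasureTheory.Integrable fun x => ∑ j, pd j (X j) x :=
  MeasureTheory.integrable_finsetSum _ fun j _ =>
    integrable_of_eq_zero_of_notMem hU (contDiffOn_pd hU (hX j) j) hK hKU
      fun _ hx => pd_eq_zero_of_notMem hK.isClosed (h j) hx j

lemma setIntegral_sum_pd_eq_zero {X : Fin 2 → Plane → ℝ} (hU : IsOpen U)
    (hX : ∀ j, ContDiffOn ℝ ∞ (X j) U) (hK : IsCompact K) (hKU : K ⊆ U)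
    (h : ∀ j, ∀ x ∉ K, X j x = 0) : ∫ x in U, ∑ j, pd j (X j) x = 0 := by
  have hzero (j : Fin 2) (x : Plane) (hx : x ∉ K) : pd j (X j) x = 0 :=
    pd_eq_zero_of_notMem hK.isClosed (h j) hx j
  rw [MeasureTheory.setIntegral_eq_integral_of_forall_compl_eq_zero fun x hx =>
      Finset.sum_eq_zero fun j _ => hzero j x fun hxK => hx (hKU hxK),
    MeasureTheory.integral_finsetSum _ fun j _ =>
      integrable_of_eq_zero_of_notMem hU (contDiffOn_pd hU (hX j) j) hK hKU (hzero j)]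
  exact Finset.sum_eq_zero fun j _ => integral_pd_eq_zero
    (contDiff_of_eq_zero_of_notMem hU (hX j) hK.isClosed hKU (h j))
    (HasCompactSupport.intro hK (h j)) j

end CompactSupport

section IntegrationByParts

variable {m : ℕ} {f : Plane → Amb m} {U : Set Plane} {x : Plane} {u : Plane → Amb m}
  {α : Fin 2 → Plane → Amb m}

namespace IsPatch

variable (hf : IsPatch f U)
include hf

lemma contDiffOn_sharpDensity (hα : ∀ i, ContDiffOn ℝ ∞ (α i) U) (j : Fin 2) :
    ContDiffOn ℝ ∞ (sharpDensity f α j) U :=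
  ContDiffOn.sum fun i _ =>
    (hf.contDiffOn_areaDensity.mul (hf.contDiffOn_metricInv i j)).smul (hα i)

lemma areaDensity_smul_codiff (hx : x ∈ U) (α : Fin 2 → Plane → Amb m) :
    areaDensity f x • codiff f α x = -∑ j, pd j (sharpDensity f α j) x := by
  rw [codiff_eq_sum_pd_sharpDensity, smul_neg, smul_inv_smul₀ (hf.areaDensity_pos hx).ne']

lemma contDiffOn_areaDensity_smul_codiff (hα : ∀ i, ContDiffOn ℝ ∞ (α i) U) :
    ContDiffOn ℝ ∞ (fun y => areaDensity f y • codiff f α y) U :=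
  (ContDiffOn.sum fun j _ => WillmoreConservation.contDiffOn_pd hf.isOpen
    (hf.contDiffOn_sharpDensity hα j) j).neg.congr fun _ hy => hf.areaDensity_smul_codiff hy α

lemma sum_pd_inner_sharpDensity (hx : x ∈ U) (hu : ContDiffOn ℝ ∞ u U)
    (hα : ∀ i, ContDiffOn ℝ ∞ (α i) U) :
    ∑ j, pd j (fun y => inner ℝ (u y) (sharpDensity f α j y)) x =
      ∑ j, inner ℝ (pd j u x) (sharpDensity f α j x)
        - areaDensity f x * inner ℝ (u x) (codiff f α x) := by
  have hprod (j : Fin 2) : pd j (fun y => inner ℝ (u y) (sharpDensity f α j y)) x =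
      inner ℝ (pd j u x) (sharpDensity f α j x) + inner ℝ (u x) (pd j (sharpDensity f α j) x) :=
    pd_inner (hf.differentiableAt hu hx) (hf.differentiableAt (hf.contDiffOn_sharpDensity hα j) hx)
  rw [← real_inner_smul_right, hf.areaDensity_smul_codiff hx, inner_neg_right, inner_sum,
    sub_neg_eq_add]
  simp only [hprod, Finset.sum_add_distrib]

end IsPatch

end IntegrationByParts

section Variation

variable {m : ℕ} {f ξ : Plane → Amb m} {U K : Set Plane} {x : Plane} {t : ℝ}

/-- The integrand `|H|² √(det g)` of the Willmore energy of `f + t ξ` at `x`, as a function of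
`(t, x)` which is smooth wherever `f + t ξ` is an immersion. -/
def variationDensity (f ξ : Plane → Amb m) (p : ℝ × Plane) : ℝ :=
  jetWillmoreDensity (fun k => pd k f p.2 + p.1 • pd k ξ p.2)
    fun i j => pd i (pd j f) p.2 + p.1 • pd i (pd j ξ) p.2

/-- The derivative in `t` of the integrand of the Willmore energy of `f + t ξ`. -/
def variationRate (f ξ : Plane → Amb m) (p : ℝ × Plane) : ℝ :=
  fderiv ℝ (variationDensity f ξ) p (1, 0)

/-- The pairs `(t, x)`, `x ∈ U`, for which `f + t ξ` is an immersion at `x`. -/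
def regularSet (f ξ : Plane → Amb m) (U : Set Plane) : Set (ℝ × Plane) :=
  {p | p.2 ∈ U ∧ Function.Injective (fderiv ℝ f p.2 + p.1 • fderiv ℝ ξ p.2)}

lemma contDiffAt_add_smul {W : Type*} [NormedAddCommGroup W] [NormedSpace ℝ W] {u v : Plane → W}
    {p : ℝ × Plane} (hu : ContDiffAt ℝ ∞ u p.2) (hv : ContDiffAt ℝ ∞ v p.2) :
    ContDiffAt ℝ ∞ (fun q : ℝ × Plane => u q.2 + q.1 • v q.2) p :=
  (hu.comp p contDiffAt_snd).add (contDiffAt_fst.smul (hv.comp p contDiffAt_snd))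

lemma pd_add_smul {W : Type*} [NormedAddCommGroup W] [NormedSpace ℝ W] {u v : Plane → W}
    (hu : DifferentiableAt ℝ u x) (hv : DifferentiableAt ℝ v x) (t : ℝ) (i : Fin 2) :
    pd i (fun y => u y + t • v y) x = pd i u x + t • pd i v x := by
  rw [pd_add hu (hv.fun_const_smul t), pd_const_smul t hv]

namespace IsPatch

variable (hf : IsPatch f U) (hξ : ContDiffOn ℝ ∞ ξ U)
include hf

lemma zero_mem_regularSet (ξ : Plane → Amb m) (hx : x ∈ U) : (0, x) ∈ regularSet f ξ U :=
  ⟨hx, by simpa using hf.injective x hx⟩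

include hξ

lemma pd_variation (hx : x ∈ U) (t : ℝ) (i : Fin 2) :
    pd i (fun y => f y + t • ξ y) x = pd i f x + t • pd i ξ x :=
  pd_add_smul (hf.differentiableAt hf.smooth hx) (hf.differentiableAt hξ hx) t i

lemma pd_pd_variation (hx : x ∈ U) (t : ℝ) (i j : Fin 2) :
    pd i (pd j fun y => f y + t • ξ y) x = pd i (pd j f) x + t • pd i (pd j ξ) x := by
  rw [pd_congr hf.isOpen hx fun y hy => hf.pd_variation hξ hy t j]
  exact pd_add_smul (hf.differentiableAt (hf.contDiffOn_pd j) hx)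
    (hf.differentiableAt (WillmoreConservation.contDiffOn_pd hf.isOpen hξ j) hx) t i

lemma isOpen_regularSet : IsOpen (regularSet f ξ U) := by
  have hderiv {u : Plane → Amb m} (hu : ContDiffOn ℝ ∞ u U) :
      ContinuousOn (fun p : ℝ × Plane => fderiv ℝ u p.2) (Prod.snd ⁻¹' U) :=
    (hu.continuousOn_fderiv_of_isOpen hf.isOpen (by simp)).comp continuousOn_snd fun _ hp => hp
  exact ((hderiv hf.smooth).add (continuousOn_fst.smul (hderiv hξ))).isOpen_inter_preimage
    (hf.isOpen.preimage continuous_snd) ContinuousLinearMap.isOpen_injective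

lemma isPatch_variation (t : ℝ) :
    IsPatch (fun y => f y + t • ξ y) {y | (t, y) ∈ regularSet f ξ U} where
  isOpen := (hf.isOpen_regularSet hξ).preimage (by fun_prop)
  smooth := (hf.smooth.add (hξ.const_smul t)).mono fun _ hy => hy.1
  injective y hy := by
    rw [fderiv_fun_add (hf.differentiableAt hf.smooth hy.1)
      ((hf.differentiableAt hξ hy.1).fun_const_smul t),
      fderiv_fun_const_smul (hf.differentiableAt hξ hy.1)]
    exact hy.2

lemma gram_variation_det_ne_zero {p : ℝ × Plane} (hp : p ∈ regularSet f ξ U) :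
    (Matrix.gram ℝ fun k => pd k f p.2 + p.1 • pd k ξ p.2).det ≠ 0 := by
  simp only [← hf.pd_variation hξ hp.1]
  exact (hf.isPatch_variation hξ p.1).det_ne_zero (x := p.2) hp

lemma norm_sq_meanCurv_mul_areaDensity_variation (hx : (t, x) ∈ regularSet f ξ U) :
    ‖meanCurv (fun y => f y + t • ξ y) x‖ ^ 2 * areaDensity (fun y => f y + t • ξ y) x =
      variationDensity f ξ (t, x) := by
  rw [(hf.isPatch_variation hξ t).meanCurv_eq_jetMeanCurv hx, variationDensity,
    jetWillmoreDensity]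
  simp only [← hf.pd_variation hξ hx.1, ← hf.pd_pd_variation hξ hx.1]
  rfl

lemma contDiffAt_variationDensity {p : ℝ × Plane} (hp : p ∈ regularSet f ξ U) :
    ContDiffAt ℝ ∞ (variationDensity f ξ) p :=
  contDiffAt_jetWillmoreDensity
    (fun k => contDiffAt_add_smul (hf.contDiffAt (hf.contDiffOn_pd k) hp.1)
      (hf.contDiffAt (WillmoreConservation.contDiffOn_pd hf.isOpen hξ k) hp.1))
    (fun i j => contDiffAt_add_smul (hf.contDiffAt (hf.contDiffOn_pd_pd i j) hp.1)
      (hf.contDiffAt (WillmoreConservation.contDiffOn_pd hf.isOpen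
        (WillmoreConservation.contDiffOn_pd hf.isOpen hξ j) i) hp.1))
    (hf.gram_variation_det_ne_zero hξ hp)

lemma continuousOn_variationRate : ContinuousOn (variationRate f ξ) (regularSet f ξ U) := by
  have h : ContDiffOn ℝ ∞ (variationDensity f ξ) (regularSet f ξ U) := fun p hp =>
    (hf.contDiffAt_variationDensity hξ hp).contDiffWithinAt
  exact (h.continuousOn_fderiv_of_isOpen (hf.isOpen_regularSet hξ) (by simp)).clm_apply
    continuousOn_const

lemma hasDerivAt_variationDensity (hx : (t, x) ∈ regularSet f ξ U) :
    HasDerivAt (fun s => variationDensity f ξ (s, x)) (variationRate f ξ (t, x)) t := by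
  have h := ((hf.contDiffAt_variationDensity hξ hx).differentiableAt (by simp)).hasFDerivAt
  exact h.comp_hasDerivAt t ((hasDerivAt_id t).prodMk (hasDerivAt_const t x))

lemma exists_closedBall_regular (hK : IsCompact K) (hKU : K ⊆ U) (h : ∀ x ∉ K, ξ x = 0) :
    ∃ ε > 0, ∀ t ∈ Metric.closedBall (0 : ℝ) ε, ∀ x ∈ U, (t, x) ∈ regularSet f ξ U := by
  have hzero : ({0} : Set ℝ) ×ˢ K ⊆ regularSet f ξ U := by
    rintro ⟨t, x⟩ ⟨rfl, hx⟩
    exact hf.zero_mem_regularSet ξ (hKU hx)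
  obtain ⟨u, v, hu, -, hzero_mem, hKv, huv⟩ :=
    generalized_tube_lemma isCompact_singleton hK (hf.isOpen_regularSet hξ) hzero
  obtain ⟨ε, hε, hball⟩ := Metric.nhds_basis_closedBall.mem_iff.1 (hu.mem_nhds (hzero_mem rfl))
  refine ⟨ε, hε, fun t ht x hx => ?_⟩
  by_cases hxK : x ∈ K
  · exact huv ⟨hball ht, hKv hxK⟩
  · have hfderiv : fderiv ℝ ξ x = 0 := by
      rw [(Filter.eventuallyEq_of_mem (hK.isClosed.isOpen_compl.mem_nhds hxK) h).fderiv_eq]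
      exact fderiv_const_apply 0
    exact ⟨hx, by simpa [hfderiv] using hf.injective x hx⟩

lemma variationRate_eq_zero (hK : IsClosed K) (h : ∀ x ∉ K, ξ x = 0)
    (hx : (t, x) ∈ regularSet f ξ U) (hxK : x ∉ K) : variationRate f ξ (t, x) = 0 := by
  refine (hf.hasDerivAt_variationDensity hξ hx).unique ?_
  have hpd (j : Fin 2) (y : Plane) (hy : y ∉ K) := pd_eq_zero_of_notMem hK h hy j
  simp only [variationDensity, hpd _ x hxK, pd_eq_zero_of_notMem hK (hpd _) hxK, smul_zero]
  exact hasDerivAt_const _ _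

theorem hasDerivAt_setIntegral_variation
    (hE : MeasureTheory.IntegrableOn (fun x => ‖meanCurv f x‖ ^ 2 * areaDensity f x) U)
    (hK : IsCompact K) (hKU : K ⊆ U) (h : ∀ x ∉ K, ξ x = 0) :
    HasDerivAt (fun t : ℝ => ∫ x in U, ‖meanCurv (fun y => f y + t • ξ y) x‖ ^ 2 *
      areaDensity (fun y => f y + t • ξ y) x) (∫ x in U, variationRate f ξ (0, x)) 0 := by
  have hU : MeasurableSet U := hf.isOpen.measurableSet
  obtain ⟨ε, hε, hreg⟩ := hf.exists_closedBall_regular hξ hK hKU h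
  have hball := Metric.ball_mem_nhds (0 : ℝ) hε
  have hreg_ball (t) (ht : t ∈ Metric.ball (0 : ℝ) ε) := hreg t (Metric.ball_subset_closedBall ht)
  have hrate := hf.continuousOn_variationRate hξ
  obtain ⟨C, hC⟩ := ((isCompact_closedBall (0 : ℝ) ε).prod hK).exists_bound_of_continuousOn
    (hrate.mono fun p hp => hreg p.1 hp.1 p.2 (hKU hp.2))
  refine (hasDerivAt_integral_of_dominated_loc_of_deriv_le (bound := K.indicator fun _ => C)
    (F' := fun t x => variationRate f ξ (t, x)) hball ?_ (by simpa using! hE) ?_ ?_ ?_ ?_).2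
  · filter_upwards [hball] with t ht
    have hp := hf.isPatch_variation hξ t
    exact (((hp.contDiffOn_meanCurv.norm_sq ℝ).mul
      hp.contDiffOn_areaDensity).continuousOn.mono (hreg_ball t ht)).aestronglyMeasurable hU
  · exact (hrate.comp (by fun_prop)
      fun x hx => hf.zero_mem_regularSet ξ hx).aestronglyMeasurable hU
  · filter_upwards [MeasureTheory.ae_restrict_mem hU] with x hx t ht
    by_cases hxK : x ∈ K
    · rw [Set.indicator_of_mem hxK]
      exact hC (t, x) ⟨Metric.ball_subset_closedBall ht, hxK⟩
    · rw [Set.indicator_of_notMem hxK,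
        hf.variationRate_eq_zero hξ hK.isClosed h (hreg_ball t ht x hx) hxK, norm_zero]
  · exact ((MeasureTheory.integrable_indicator_iff hK.measurableSet).2
      (MeasureTheory.integrableOn_const hK.measure_lt_top.ne)).integrableOn
  · filter_upwards [MeasureTheory.ae_restrict_mem hU] with x hx t ht
    refine (hf.hasDerivAt_variationDensity hξ (hreg_ball t ht x hx)).congr_of_eventuallyEq ?_
    filter_upwards [Metric.isOpen_ball.mem_nhds ht] with s hs
    exact hf.norm_sq_meanCurv_mul_areaDensity_variation hξ (hreg_ball s hs x hx)

end IsPatch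

end Variation

lemma eqOn_zero_of_setIntegral_inner_eq_zero {V E : Type*} [NormedAddCommGroup V]
    [NormedSpace ℝ V] [FiniteDimensional ℝ V] [MeasurableSpace V] [BorelSpace V]
    {μ : MeasureTheory.Measure V} [MeasureTheory.IsLocallyFiniteMeasure μ] [μ.IsOpenPosMeasure]
    [NormedAddCommGroup E] [InnerProductSpace ℝ E] {U : Set V} (hU : IsOpen U) {F : V → E}
    (hF : ContinuousOn F U)
    (h : ∀ ξ : V → E, ContDiff ℝ ∞ ξ → HasCompactSupport ξ → tsupport ξ ⊆ U →
      ∫ x in U, inner ℝ (ξ x) (F x) ∂μ = 0) : Set.EqOn F 0 U := by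
  intro x hx
  refine ext_inner_left ℝ fun w => ?_
  have hcont : ContinuousOn (fun y => inner ℝ w (F y)) U := continuousOn_const.inner hF
  have hae := hU.ae_eq_zero_of_integral_contDiff_smul_eq_zero (μ := μ)
    (hcont.locallyIntegrableOn hU.measurableSet) fun g hg hgs hgU => by
      have hsub : tsupport (fun y => g y • w) ⊆ tsupport g :=
        closure_mono (Function.support_smul_subset_left g fun _ => w)
      rw [← h (fun y => g y • w) (hg.smul contDiff_const) hgs.smul_right (hsub.trans hgU),
        MeasureTheory.setIntegral_eq_integral_of_forall_compl_eq_zero fun y hy => by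
          rw [image_eq_zero_of_notMem_tsupport fun hyg => hy (hgU hyg), zero_smul,
            inner_zero_left]]
      simp only [real_inner_smul_left, smul_eq_mul]
  exact (MeasureTheory.Measure.eqOn_open_of_ae_eq
    ((MeasureTheory.ae_restrict_iff' hU.measurableSet).2 hae) hU hcont continuousOn_const hx).trans
      (inner_zero_right w).symm

section EulerLagrange

variable {m : ℕ} {f ξ : Plane → Amb m} {U : Set Plane} {x : Plane}

/-- The vector field whose flat divergence is the difference between the first variation of the
Willmore integrand in the direction `ξ` and `½ ⟨ξ, d^{*_g} C⟩ √(det g)`, where `C` is the form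
`conservedForm f`. -/
def variationFlux (f ξ : Plane → Amb m) (j : Fin 2) (x : Plane) : ℝ :=
  inner ℝ (meanCurv f x) (sharpDensity f (fun i => pd i ξ) j x)
    + (1 / 2 : ℝ) • inner ℝ (ξ x) (sharpDensity f (conservedForm f) j x)

lemma sum_inner_sharpDensity (f : Plane → Amb m) (α : Fin 2 → Plane → Amb m) (x : Plane)
    (v : Fin 2 → Amb m) : ∑ j, inner ℝ (v j) (sharpDensity f α j x) =
      areaDensity f x * ∑ i, ∑ j, metricInv f x i j * inner ℝ (v j) (α i x) := by
  simp only [sharpDensity, inner_sum, real_inner_smul_right, mul_assoc, ← Finset.mul_sum]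
  rw [Finset.sum_comm]

namespace IsPatch

variable (hf : IsPatch f U)
include hf

lemma contDiffOn_conservedForm (i : Fin 2) : ContDiffOn ℝ ∞ (conservedForm f i) U :=
  (((hf.contDiffOn_normalD i).const_smul (-2 : ℝ)).add
    ((hf.contDiffOn_traceFreeForm i).const_smul (2 : ℝ))).congr fun _ hy =>
      hf.conservedForm_eq hy i

lemma pd_meanCurv_add_conservedForm (hx : x ∈ U) (i : Fin 2) :
    pd i (meanCurv f) x + (1 / 2 : ℝ) • conservedForm f i x =
      ‖meanCurv f x‖ ^ 2 • pd i f x - (2 : ℝ) • shapeForm f i x := by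
  rw [hf.conservedForm_eq hx, hf.normalD_meanCurv hx, traceFreeForm]
  module

lemma variationRate_zero (hξ : ContDiffOn ℝ ∞ ξ U) (hx : x ∈ U) :
    variationRate f ξ (0, x) = areaDensity f x *
      (∑ i, ∑ j, metricInv f x i j * inner ℝ (pd j ξ x)
          (pd i (meanCurv f) x + (1 / 2 : ℝ) • conservedForm f i x)
        - inner ℝ (meanCurv f x) (codiff f (fun i => pd i ξ) x)) := by
  have hpdξ (i : Fin 2) := WillmoreConservation.contDiffOn_pd hf.isOpen hξ i
  have hhessian : ∑ i, ∑ j, metricInv f x i j * inner ℝ (meanCurv f x) (pd i (pd j ξ) x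
        - ∑ k, ∑ l, (metricInv f x k l * inner ℝ (pd k f x) (pd i (pd j f) x)) • pd l ξ x) =
      -inner ℝ (meanCurv f x) (codiff f (fun i => pd i ξ) x) := by
    rw [hf.inner_codiff hx fun i => hf.differentiableAt (hpdξ i) hx]
    simp only [christoffel, inner_sub_right, inner_add_right, real_inner_smul_right,
      Fin.sum_univ_two, metricInv_symm f x 1 0, real_inner_comm (pd _ f x),
      WillmoreConservation.pd_comm hf.isOpen hξ hx 1 0]
    ring
  have hmetric : ∑ i, ∑ j, (∑ q, ∑ p, metricInv f x i p * (inner ℝ (pd p f x) (pd q ξ x)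
        + inner ℝ (pd p ξ x) (pd q f x)) * metricInv f x q j) *
        inner ℝ (meanCurv f x) (pd i (pd j f) x) =
      2 * ∑ i, ∑ j, metricInv f x i j * inner ℝ (pd j ξ x) (shapeForm f i x) := by
    simp only [shapeForm, meanSecondForm, inner_add_right, real_inner_smul_right,
      Fin.sum_univ_two, metricInv_symm f x 1 0, real_inner_comm (pd _ ξ x), hf.pd_comm hx 1 0]
    ring
  have hrate := (hf.hasDerivAt_variationDensity hξ (hf.zero_mem_regularSet ξ hx)).unique
    (hasDerivAt_jetWillmoreDensity_add_smul (hf.det_ne_zero hx) (fun i => pd i ξ x)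
      (fun i j => pd i (pd j f) x) fun i j => pd i (pd j ξ) x)
  have hinv : (Matrix.gram ℝ fun i => pd i f x)⁻¹ = metricInv f x := rfl
  have hdensity : √(Matrix.gram ℝ fun i => pd i f x).det = areaDensity f x := rfl
  rw [hrate, hdensity, hinv, ← hf.meanCurv_eq_jetMeanCurv hx, hhessian, hmetric]
  simp only [hf.pd_meanCurv_add_conservedForm hx, inner_sub_right, real_inner_smul_right,
    real_inner_comm (pd _ ξ x), Fin.sum_univ_two]
  ring

lemma contDiffOn_variationFlux (hξ : ContDiffOn ℝ ∞ ξ U) (j : Fin 2) :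
    ContDiffOn ℝ ∞ (variationFlux f ξ j) U :=
  (hf.contDiffOn_meanCurv.inner ℝ (hf.contDiffOn_sharpDensity
    (fun i => WillmoreConservation.contDiffOn_pd hf.isOpen hξ i) j)).add
      ((hξ.inner ℝ (hf.contDiffOn_sharpDensity hf.contDiffOn_conservedForm j)).const_smul _)

lemma variationRate_zero_eq_add_sum_pd (hξ : ContDiffOn ℝ ∞ ξ U) (hx : x ∈ U) :
    variationRate f ξ (0, x) =
      1 / 2 * inner ℝ (ξ x) (areaDensity f x • codiff f (conservedForm f) x)
        + ∑ j, pd j (variationFlux f ξ j) x := by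
  have hpdξ (i : Fin 2) := WillmoreConservation.contDiffOn_pd hf.isOpen hξ i
  have hflux (j : Fin 2) : pd j (variationFlux f ξ j) x =
      pd j (fun y => inner ℝ (meanCurv f y) (sharpDensity f (fun i => pd i ξ) j y)) x
        + (1 / 2 : ℝ) • pd j (fun y => inner ℝ (ξ y) (sharpDensity f (conservedForm f) j y)) x := by
    have hinner {u v : Plane → Amb m} (hu : ContDiffOn ℝ ∞ u U) (hv : ContDiffOn ℝ ∞ v U) :
        DifferentiableAt ℝ (fun y => inner ℝ (u y) (v y)) x :=
      hf.differentiableAt (hu.inner ℝ hv) hx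
    have hC := hinner hξ (hf.contDiffOn_sharpDensity hf.contDiffOn_conservedForm j)
    unfold variationFlux
    rw [pd_add (hinner hf.contDiffOn_meanCurv (hf.contDiffOn_sharpDensity hpdξ j))
      (hC.fun_const_smul _), pd_const_smul _ hC]
  simp only [hflux, Finset.sum_add_distrib, ← Finset.smul_sum]
  rw [hf.sum_pd_inner_sharpDensity hx hf.contDiffOn_meanCurv hpdξ,
    hf.sum_pd_inner_sharpDensity hx hξ hf.contDiffOn_conservedForm, sum_inner_sharpDensity,
    sum_inner_sharpDensity, hf.variationRate_zero hξ hx]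
  simp only [inner_add_right, real_inner_smul_right, smul_eq_mul, Fin.sum_univ_two,
    metricInv_symm f x 1 0, real_inner_comm (pd _ ξ x)]
  ring

theorem hasDerivAt_setIntegral_variation_eq
    (hE : MeasureTheory.IntegrableOn (fun x => ‖meanCurv f x‖ ^ 2 * areaDensity f x) U)
    (hξ : ContDiff ℝ ∞ ξ) (hs : HasCompactSupport ξ) (hsU : tsupport ξ ⊆ U) :
    HasDerivAt (fun t : ℝ => ∫ x in U, ‖meanCurv (fun y => f y + t • ξ y) x‖ ^ 2 *
      areaDensity (fun y => f y + t • ξ y) x)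
      (1 / 2 * ∫ x in U, inner ℝ (ξ x) (areaDensity f x • codiff f (conservedForm f) x)) 0 := by
  have hzero (x) (hx : x ∉ tsupport ξ) : ξ x = 0 := image_eq_zero_of_notMem_tsupport hx
  have hflux_zero (j) (x) (hx : x ∉ tsupport ξ) : variationFlux f ξ j x = 0 := by
    simp only [variationFlux, sharpDensity, hzero x hx,
      pd_eq_zero_of_notMem (isClosed_tsupport ξ) hzero hx, smul_zero, Finset.sum_const_zero,
      inner_zero_left, inner_zero_right, add_zero]
  have hflux := hf.contDiffOn_variationFlux hξ.contDiffOn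
  have hint := integrable_of_eq_zero_of_notMem hf.isOpen (hξ.contDiffOn.inner ℝ
    (hf.contDiffOn_areaDensity_smul_codiff hf.contDiffOn_conservedForm)) hs hsU
    fun x hx => by rw [hzero x hx, inner_zero_left]
  refine (hf.hasDerivAt_setIntegral_variation hξ.contDiffOn hE hs hsU hzero).congr_deriv ?_
  rw [MeasureTheory.setIntegral_congr_fun hf.isOpen.measurableSet fun x hx =>
      hf.variationRate_zero_eq_add_sum_pd hξ.contDiffOn hx,
    MeasureTheory.integral_add (hint.const_mul _).integrableOn
      (integrable_sum_pd hf.isOpen hflux hs hsU hflux_zero).integrableOn,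
    setIntegral_sum_pd_eq_zero hf.isOpen hflux hs hsU hflux_zero,
    MeasureTheory.integral_const_mul, add_zero]

theorem forall_hasDerivAt_zero_iff_codiff_eq_zero
    (hE : MeasureTheory.IntegrableOn (fun x => ‖meanCurv f x‖ ^ 2 * areaDensity f x) U) :
    (∀ ξ : Plane → Amb m, ContDiff ℝ ∞ ξ → HasCompactSupport ξ → tsupport ξ ⊆ U →
      HasDerivAt (fun t : ℝ => ∫ x in U, ‖meanCurv (fun y => f y + t • ξ y) x‖ ^ 2 *
        areaDensity (fun y => f y + t • ξ y) x) 0 0) ↔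
      ∀ x ∈ U, codiff f (conservedForm f) x = 0 := by
  refine ⟨fun hcrit x hx => ?_, fun hcodiff ξ hξ hs hsU => ?_⟩
  · have hzero := eqOn_zero_of_setIntegral_inner_eq_zero (μ := MeasureTheory.volume) hf.isOpen
      (hf.contDiffOn_areaDensity_smul_codiff hf.contDiffOn_conservedForm).continuousOn
      fun ξ hξ hs hsU => by
        linarith [(hcrit ξ hξ hs hsU).unique (hf.hasDerivAt_setIntegral_variation_eq hE hξ hs hsU)]
    exact (smul_eq_zero.1 (hzero hx)).resolve_left (hf.areaDensity_pos hx).ne'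
  · refine (hf.hasDerivAt_setIntegral_variation_eq hE hξ hs hsU).congr_deriv ?_
    rw [MeasureTheory.setIntegral_eq_zero_of_forall_eq_zero fun x hx => by
      rw [hcodiff x hx, smul_zero, inner_zero_right], mul_zero]

end IsPatch

end EulerLagrange

/-! ### Conformal coordinates -/

section Conformal

variable {m : ℕ} {f : Plane → Amb m} {U : Set Plane} {x : Plane}

lemma areaDensity_smul_metricInv_of_conformal (hdet : (metric f x).det ≠ 0)
    (hnorm : ‖pd 0 f x‖ = ‖pd 1 f x‖) (horth : inner ℝ (pd 0 f x) (pd 1 f x) = 0) :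
    areaDensity f x • metricInv f x = 1 := by
  have hmetric : metric f x = (‖pd 0 f x‖ ^ 2) • 1 := by
    ext i j
    fin_cases i <;> fin_cases j <;>
      simp [metric, horth, real_inner_comm, ← hnorm]
  have harea : areaDensity f x = ‖pd 0 f x‖ ^ 2 := by
    rw [areaDensity, hmetric, Matrix.det_smul, Matrix.det_one, mul_one, Fintype.card_fin,
      Real.sqrt_sq (sq_nonneg _)]
  rw [harea, metricInv, ← smul_one_mul, ← hmetric,
    Matrix.mul_nonsing_inv _ hdet.isUnit]

lemma areaDensity_mul_metricInv_of_conformal (hdet : (metric f x).det ≠ 0)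
    (hnorm : ‖pd 0 f x‖ = ‖pd 1 f x‖) (horth : inner ℝ (pd 0 f x) (pd 1 f x) = 0) (i j : Fin 2) :
    areaDensity f x * metricInv f x i j = if i = j then 1 else 0 := by
  rw [← Matrix.one_apply, ← areaDensity_smul_metricInv_of_conformal hdet hnorm horth,
    Matrix.smul_apply, smul_eq_mul]

lemma sharpDensity_of_conformal (hdet : (metric f x).det ≠ 0)
    (hnorm : ‖pd 0 f x‖ = ‖pd 1 f x‖) (horth : inner ℝ (pd 0 f x) (pd 1 f x) = 0)
    (α : Fin 2 → Plane → Amb m) (j : Fin 2) : sharpDensity f α j x = α j x := by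
  simp only [sharpDensity, areaDensity_mul_metricInv_of_conformal hdet hnorm horth, ite_smul,
    one_smul, zero_smul, Finset.sum_ite_eq', Finset.mem_univ, if_true]

lemma conservedForm_eq_conservedField_of_conformal (hdet : (metric f x).det ≠ 0)
    (hnorm : ‖pd 0 f x‖ = ‖pd 1 f x‖) (horth : inner ℝ (pd 0 f x) (pd 1 f x) = 0) (i : Fin 2) :
    conservedForm f i x = conservedField f i x := by
  have hstar : starOne f (fun j => pdMulti j (gaussMap f)) i x = perpGradGauss f i x := by
    fin_cases i <;>
      simp [starOne, perpGradGauss, smul_smul,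
        areaDensity_mul_metricInv_of_conformal hdet hnorm horth]
  rw [conservedForm, hstar, conservedField, normalD]

lemma IsPatch.areaDensity_smul_codiff_conservedForm_of_conformal (hf : IsPatch f U)
    (hconf : ∀ y ∈ U, ‖pd 0 f y‖ = ‖pd 1 f y‖ ∧ inner ℝ (pd 0 f y) (pd 1 f y) = 0) (hx : x ∈ U) :
    areaDensity f x • codiff f (conservedForm f) x = -flatDiv (conservedField f) x := by
  have hsharp (j : Fin 2) :
      pd j (sharpDensity f (conservedForm f) j) x = pd j (conservedField f j) x :=
    pd_congr hf.isOpen hx fun y hy => by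
      have hdet := hf.det_ne_zero hy
      obtain ⟨hnorm, horth⟩ := hconf y hy
      rw [sharpDensity_of_conformal hdet hnorm horth,
        conservedForm_eq_conservedField_of_conformal hdet hnorm horth]
  rw [hf.areaDensity_smul_codiff hx, Fin.sum_univ_two, hsharp, hsharp, flatDiv]

end Conformal

section Disc

variable {m : ℕ} {f : Plane → Amb m} {x : Plane}

lemma IsDiscImmersion.isPatch (hf : IsDiscImmersion f) : IsPatch f disc :=
  ⟨Metric.isOpen_ball, hf.smooth, hf.injective⟩

theorem IsDiscImmersion.isWillmoreDisc_iff (hf : IsDiscImmersion f) (hE : HasFiniteEnergy f) :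
    IsWillmoreDisc f ↔ ∀ x ∈ disc, codiff f (conservedForm f) x = 0 :=
  ⟨fun hW => (hf.isPatch.forall_hasDerivAt_zero_iff_codiff_eq_zero hE).1 hW.critical,
    fun h => ⟨hf, hE, (hf.isPatch.forall_hasDerivAt_zero_iff_codiff_eq_zero hE).2 h⟩⟩

lemma IsDiscImmersion.codiff_conservedForm_eq_zero_iff (hf : IsDiscImmersion f)
    (hconf : IsConformalOnDisc f) (hx : x ∈ disc) :
    codiff f (conservedForm f) x = 0 ↔ flatDiv (conservedField f) x = 0 := by
  rw [← neg_eq_zero (a := flatDiv _ _),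
    ← hf.isPatch.areaDensity_smul_codiff_conservedForm_of_conformal hconf hx,
    smul_eq_zero_iff_right (hf.isPatch.areaDensity_pos hx).ne']

end Disc

theorem mainTheorem8_general (m : ℕ) :
    (∀ (f : Plane → Amb m) (U : Set Plane), IsPatch f U → ∀ x ∈ U, ∀ e : Fin 2 → Plane,
      Orthonormal ℝ (fun i => fderiv ℝ f x (e i)) →
      normalLaplacian f (meanCurv f) x + tildeA f x e (meanCurv f x)
          - (2 * ‖meanCurv f x‖ ^ 2) • meanCurv f x
        = (1 / 2 : ℝ) • codiff f (conservedForm f) x) ∧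
    (∀ f : Plane → Amb m, IsDiscImmersion f → HasFiniteEnergy f →
      (IsWillmoreDisc f ↔ ∀ x ∈ disc, codiff f (conservedForm f) x = 0)) :=
  ⟨fun _ _ hf _ hx _ he => hf.willmore_identity hx he, fun _ hf hE => hf.isWillmoreDisc_iff hE⟩

end WillmoreConservation

end

open WillmoreConservation in
/-- First part: the identity, in all local coordinates of the surface. Second part: the
characterization of conformal Willmore discs. -/
theorem mainTheorem8 (m : ℕ) :
    (∀ (M : Type*) [TopologicalSpace M] [ChartedSpace Plane M] [IsManifold (𝓡 2) ∞ M]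
      (Φ : M → Amb m), ContMDiff (𝓡 2) 𝓘(ℝ, Amb m) ∞ Φ →
      (∀ p, Function.Injective (mfderiv (𝓡 2) 𝓘(ℝ, Amb m) Φ p)) →
      ∀ φ ∈ IsManifold.maximalAtlas (𝓡 2) ∞ M, ∀ x ∈ φ.target, ∀ e : Fin 2 → Plane,
        Orthonormal ℝ (fun i => fderiv ℝ (Φ ∘ φ.symm) x (e i)) →
        normalLaplacian (Φ ∘ φ.symm) (meanCurv (Φ ∘ φ.symm)) x
            + tildeA (Φ ∘ φ.symm) x e (meanCurv (Φ ∘ φ.symm) x)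
            - (2 * ‖meanCurv (Φ ∘ φ.symm) x‖ ^ 2) • meanCurv (Φ ∘ φ.symm) x
          = (1 / 2 : ℝ) • codiff (Φ ∘ φ.symm) (conservedForm (Φ ∘ φ.symm)) x) ∧
    (∀ f : Plane → Amb m, IsDiscImmersion f → IsConformalOnDisc f → HasFiniteEnergy f →
      (IsWillmoreDisc f ↔ ∀ x ∈ disc, flatDiv (conservedField f) x = 0)) :=
  ⟨fun _ _ _ _ _ hΦ hinj _ hφ x hx e he =>
      (mainTheorem8_general m).1 _ _ (isPatch_of_chart hΦ hinj hφ) x hx e he,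
    fun f hf hconf hE => ((mainTheorem8_general m).2 f hf hE).trans <|
      forall₂_congr fun _ hx => hf.codiff_conservedForm_eq_zero_iff hconf hx⟩
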